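/- Let $n,m\ge 0$, let $J\subset\mathbb R$ (the times) and $\Omega\subset\mathbb R^n$ be open. A mean curvature flow is a map $F:J\times\Omega\to\mathbb R^{n+m}$ of class $C^3$ such that every $F_t=F(t,\cdot)$ is an immersion and $\partial F/\partial t=H$, the mean curvature vector (the trace of the second fundamental form) of $\Sigma_t=F_t(\Omega)$. Put $\partial_i=\partial F/\partial x^i$, $g_{ij}=\partial_i\cdot\partial_j$, $(g^{ij})=(g_{ij})^{-1}$, $g=\det(g_{ij})$. Functions on $\Sigma_t$ are read in the parameters $x$, $\Delta_\Sigma f=\frac1{\sqrt g}\,\partial_i\big(\sqrt g\,g^{ij}\partial_j f\big)$ is the Laplacian of $\Sigma_t$, $h(X,Y)=(\nabla_XY)^N$ its second fundamental form, i.e. $h(\partial_i,\partial_j)=(\partial_i\partial_jF)^N$, and $|A|^2=g^{ik}g^{jl}\langle h(\partial_i,\partial_j),h(\partial_k,\partial_l)\rangle$ its squared norm; in orthonormal bases $\tau_i$, $\nu_\alpha$ of the tangent and the normal space, $|A|^2=\sum_{\alpha,i,k}(h^\alpha_{ik})^2$ with $h^\alpha_{ik}=h(\tau_i,\tau_k)\cdot\nu_\alpha$.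 Let $\omega=dx^1\wedge\dots\wedge dx^n$ on $\mathbb R^{n+m}=\mathbb R^n\times\mathbb R^m$. All functions to which $\frac{\partial}{\partial t}-\Delta_\Sigma$ is applied below are of class $C^2$ (near the point considered) in $(t,x)$. (1) Let $F$ be a mean curvature flow, $(t,x)\in J\times\Omega$, let $\tau_1,\dots,\tau_n$ be an orthonormal frame of the tangent spaces of the $\Sigma_s$, defined near $(t,x)$ and continuous at $(t,x)$, and $\nu_1,\dots,\nu_m$ an orthonormal basis of the normal space of $\Sigma_t$ at $F(t,x)$. Then $\omega_{1\cdots n}=\omega(\tau_1,\dots,\tau_n)$ satisfies at $(t,x)$ $$\Big(\frac{\partial}{\partial t}-\Delta_\Sigma\Big)\omega_{1\cdots n}=\omega_{1\cdots n}\sum_{\alpha,i,k}(h^\alpha_{ik})^2-\sum_{i\ne j}\sum_{k,\alpha,\beta}\omega_{1\cdots\alpha^i\cdots\beta^j\cdots n}\,h^\alpha_{ik}h^\beta_{jk},$$ where $\omega_{1\cdots\alpha^i\cdots\beta^j\cdots n}$ is $\omega(\tau_1,\dots,\tau_n)$ with $\tau_i$ replaced by $\nu_\alpha$ and $\tau_j$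 by $\nu_\beta$. (2) Let $F$ be a mean curvature flow and suppose that for each $t\in J$ the set $\Sigma_t$ is the graph of a differentiable map $u_t:U_t\to\mathbb R^m$, $U_t\subset\mathbb R^n$ open. At the point $F(t,x)=(y,u_t(y))$ put $*\omega=\det\big(I+Du_t(y)^TDu_t(y)\big)^{-1/2}$. Let $\delta<2$. At every $(t,x)\in J\times\Omega$ at which $*\omega\ge\frac1{\sqrt{2-\delta}}$, $$\Big(\frac{\partial}{\partial t}-\Delta_\Sigma\Big){*\omega}\ \ge\ \delta\,{*\omega}\,|A|^2 .$$ (3) The same estimate holds, under the same pointwise condition, for every solution $u:J\times\Omega\to\mathbb R^m$ of class $C^3$ of the non-parametric mean curvature flow system $\frac{\partial u}{\partial t}=\sum_{i,j} g^{ij}(Du)\,\partial_i\partial_ju$, $g_{ij}(Du)=\delta_{ij}+\partial_iu\cdot\partial_ju$. Here $*\omega=\det(I+Du^TDu)^{-1/2}$, $\Sigma_t$ is the graph of $u(t,\cdot)$, parametrized by $F(t,x)=(x,u(t,x))$, and $\frac{\partial}{\partial t}$ in the estimate is the derivative along the normal trajectories of the moving graphs, $\frac{\partial f}{\partial t}-g^{ij}\langle\frac{\partial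 F}{\partial t},\partial_iF\rangle\,\partial_jf$. -/

import Mathlib

noncomputable section

namespace GraphMCF

variable {n m : ℕ}

/-- `ℝⁿ` with its Euclidean structure. -/
abbrev E (n : ℕ) : Type := EuclideanSpace ℝ (Fin n)

/-- The ambient space `ℝⁿ⁺ᵐ = ℝⁿ × ℝᵐ` with its Euclidean structure; the coordinates indexed by
`Sum.inl i` are the first `n` ones, those indexed by `Sum.inr α` the last `m` ones. -/
abbrev Amb (n m : ℕ) : Type := EuclideanSpace ℝ (Fin n ⊕ Fin m)

/-- The projection of `ℝⁿ⁺ᵐ` onto the first `n` coordinates. -/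
def fstPart (p : Amb n m) : E n := WithLp.toLp 2 fun i => p (Sum.inl i)

/-- The point `(x, y)` of `ℝⁿ⁺ᵐ`. -/
def pair (x : E n) (y : E m) : Amb n m := WithLp.toLp 2 (Sum.elim (fun i => x i) fun α => y α)

/-- The constant `n`-form `ω = dx¹ ∧ … ∧ dxⁿ` on `ℝⁿ⁺ᵐ`: the determinant of the first `n`
coordinates of its `n` arguments. -/
def omega (n m : ℕ) : (Amb n m) [⋀^Fin n]→ₗ[ℝ] ℝ :=
  (Matrix.detRowAlternating (n := Fin n) (R := ℝ)).compLinearMap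
    { toFun := fun p i => p (Sum.inl i)
      map_add' := fun _ _ => rfl
      map_smul' := fun _ _ => rfl }

/-- The coordinate vector `e_i` of `ℝⁿ`. -/
def ei (i : Fin n) : E n := EuclideanSpace.single i 1

/-! ### Geometry of an immersed submanifold with local parametrization `F` -/

/-- The coordinate tangent vector `∂F/∂xⁱ`. -/
def tang (F : E n → Amb n m) (x : E n) (i : Fin n) : Amb n m := fderiv ℝ F x (ei i)

/-- The induced metric `g_ij = ∂_i F · ∂_j F`. -/
def metric (F : E n → Amb n m) (x : E n) : Matrix (Fin n) (Fin n) ℝ :=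
  Matrix.of fun i j => inner ℝ (tang F x i) (tang F x j)

/-- The inverse metric `g^ij`. -/
def metricInv (F : E n → Amb n m) (x : E n) : Matrix (Fin n) (Fin n) ℝ := (metric F x)⁻¹

/-- The tangent space at `F x`. -/
def tangentSpace (F : E n → Amb n m) (x : E n) : Submodule ℝ (Amb n m) :=
  LinearMap.range (fderiv ℝ F x : E n →ₗ[ℝ] Amb n m)

/-- The orthogonal projection onto the normal space at `F x`. -/
def normalPart (F : E n → Amb n m) (x : E n) (v : Amb n m) : Amb n m :=
  (tangentSpace F x)ᗮ.starProjection v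

/-- The second fundamental form `h(dF a, dF b)`, the normal part of the derivative in direction
`dF a` of the tangent field `dF b`, i.e. `(D²F(a, b))ᴺ`. -/
def secondFF (F : E n → Amb n m) (x : E n) (a b : E n) : Amb n m :=
  normalPart F x (fderiv ℝ (fderiv ℝ F) x a b)

/-- The mean curvature vector `H = ∑ g^ij h(∂_i F, ∂_j F)`, the trace of `h`. -/
def meanCurvature (F : E n → Amb n m) (x : E n) : Amb n m :=
  ∑ i, ∑ j, metricInv F x i j • secondFF F x (ei i) (ei j)

/-- The squared norm `|A|² = ∑ g^ik g^jl ⟨h_ij, h_kl⟩` of the second fundamental form. -/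
def normSqA (F : E n → Amb n m) (x : E n) : ℝ :=
  ∑ i, ∑ j, ∑ k, ∑ l, metricInv F x i k * metricInv F x j l *
    inner ℝ (secondFF F x (ei i) (ei j)) (secondFF F x (ei k) (ei l))

/-- The Laplacian of the induced metric, `Δ_Σ f = g^{-1/2} ∂_i (g^{1/2} g^ij ∂_j f)`, where
`g = det (g_ij)`. -/
def laplacian (F : E n → Amb n m) (f : E n → ℝ) (x : E n) : ℝ :=
  (Real.sqrt (metric F x).det)⁻¹ * ∑ i, fderiv ℝ
    (fun y => Real.sqrt (metric F y).det * ∑ j, metricInv F y i j * fderiv ℝ f y (ei j)) x (ei i)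

/-! ### Mean curvature flow -/

/-- `F` is a mean curvature flow of immersions of `Ω`, for times in `J`: `∂F/∂t = H`. -/
structure IsMeanCurvatureFlow (J : Set ℝ) (Ω : Set (E n)) (F : ℝ → E n → Amb n m) : Prop where
  contDiffOn : ContDiffOn ℝ 3 (fun p : ℝ × E n => F p.1 p.2) (J ×ˢ Ω)
  immersion : ∀ t ∈ J, ∀ x ∈ Ω, Function.Injective (fderiv ℝ (F t) x)
  flow : ∀ t ∈ J, ∀ x ∈ Ω, HasDerivAt (fun s => F s x) (meanCurvature (F t) x) t

/-- The Jacobian matrix of `u : ℝⁿ → ℝᵐ` (rows indexed by the components of `u`). -/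
def jacobian (u : E n → E m) (x : E n) : Matrix (Fin m) (Fin n) ℝ :=
  Matrix.of fun α i => fderiv ℝ u x (ei i) α

/-- `*ω = 1 / √det (I + Duᵀ Du)`. -/
def starOmega (u : E n → E m) (x : E n) : ℝ :=
  1 / Real.sqrt (1 + (jacobian u x).transpose * jacobian u x).det

/-- The parametrization `x ↦ (x, u x)` of the graph of `u`. -/
def graphMap (u : E n → E m) (x : E n) : Amb n m := pair x (u x)

/-- `u` solves the non-parametric mean curvature flow system
`∂u/∂t = ∑ g^ij(Du) ∂_i ∂_j u`, where `g_ij = δ_ij + ∂_i u · ∂_j u`, on `J × Ω`. -/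
structure IsGraphicalFlow (J : Set ℝ) (Ω : Set (E n)) (u : ℝ → E n → E m) : Prop where
  contDiffOn : ContDiffOn ℝ 3 (fun p : ℝ × E n => u p.1 p.2) (J ×ˢ Ω)
  flow : ∀ t ∈ J, ∀ x ∈ Ω, HasDerivAt (fun s => u s x)
    (∑ i, ∑ j, ((1 + (jacobian (u t) x).transpose * jacobian (u t) x)⁻¹ :
        Matrix (Fin n) (Fin n) ℝ) i j •
      fderiv ℝ (fderiv ℝ (u t)) x (ei i) (ei j)) t

/-- The time derivative of `f` along the normal trajectories of the moving submanifolds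
parametrized by `F t`: the derivative at fixed `x` is corrected by the derivative of `f` in the
direction of the tangential part `∑ g^ij ⟨∂F/∂t, ∂_i F⟩ ∂_j F` of the velocity. It is the plain
`∂f/∂t` if the velocity is normal. -/
def normalTimeDeriv (F : ℝ → E n → Amb n m) (f : ℝ → E n → ℝ) (t : ℝ) (x : E n) : ℝ :=
  deriv (fun s => f s x) t -
    ∑ i, ∑ j, metricInv (F t) x i j * inner ℝ (deriv (fun s => F s x) t) (tang (F t) x i) *
      fderiv ℝ (f t) x (ei j)

end GraphMCF

end

open GraphMCF

/-!
The evolution equation of `ω` on the tangent planes of a mean curvature flow, and the resulting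
differential inequality for graphs.

Write `L = dF : ℝⁿ → ℝⁿ⁺ᵐ` and consider the function
`φ(L) = ω(L e₁, …, L eₙ) / √det ⟨L eᵢ, L eⱼ⟩` (`unitOmega`) on injective linear maps. Locally, both
`ω(τ₁, …, τₙ)` for an orthonormal frame and `*ω` of a graph are a constant sign times `φ(dF)`
(`eventuallyEq_of_frame`, `eventuallyEq_of_graph`), so all three parts are statements about the
parabolic operator applied to `φ(dF)`.

In all three parts the velocity `∂F/∂t` differs from the trace `∑ gⁱʲ ∂ᵢ∂ⱼF` by a tangential
vector. Differentiating this relation in space and inserting it into the chain rule for `φ(dF)`,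
all third derivatives of `F` cancel. What remains depends only on `D²F`, and there the tangential
parts (the Christoffel symbols) cancel as well. The reason is the invariance `φ(L ∘ A) = φ(L)` for
`det A > 0`, which gives `Dφ(L)[L ∘ C] = 0` and `D²φ(L)[L ∘ C, W] = -Dφ(L)[W ∘ C]`
(`fderiv_unitOmega_self_comp`, `fderiv_fderiv_unitOmega_self_comp`). The result
(`normalTimeDeriv_sub_laplacian_eq`) is that the operator applied to `φ(dF)` equals
`-∑ gⁱʲ D²φ(L)[hᵢ, hⱼ]`, where `hᵢ = h(∂ᵢ, ·)` is the second fundamental form. In an orthonormal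
tangent frame the Hessian of `φ` in a normal direction is explicit
(`fderiv_fderiv_unitOmega_normal`), because `det (1 + s² M)` has no first order term in `s`. This is
the evolution equation.

For the inequality, let `p = ω(τ)`. If `K` is the matrix that expresses the projections to `ℝⁿ` of
the vectors `h(τₖ, τᵢ)` through those of the `τⱼ`, the quadratic term is
`p ((tr K)² - tr K²)`, a sum of products of `2 × 2` minors of two factors `H`, `N` of `K`, where `H`
holds the components of `h(τₖ, ·)` and `N` expresses the projections of the normal frame through
those of the `τⱼ`. For `p > 0`, the Cauchy-Schwarz inequality bounds it by `p |H|² |N|²`, and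
`1 + |N|² ≤ det (1 + Nᵀ N) = p⁻²` (`omega_mul_sum_le`). The condition
`*ω ≥ 1/√(2 - δ)` says exactly that `p⁻² - 1 ≤ 1 - δ`.
-/

section

open Matrix
open scoped Topology

/-! ### Derivatives of determinants and inverse matrices -/

section MatrixCalculus

variable {X : Type*} [NormedAddCommGroup X] [NormedSpace ℝ X] {ι : Type*} [Fintype ι]
  [DecidableEq ι] {M : X → Matrix ι ι ℝ} {x : X} {k : WithTop ℕ∞}

lemma contDiffAt_matrix_det (hM : ∀ i j, ContDiffAt ℝ k (fun y => M y i j) x) :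
    ContDiffAt ℝ k (fun y => (M y).det) x := by
  simp only [Matrix.det_apply']
  exact ContDiffAt.sum fun σ _ => contDiffAt_const.mul
    (contDiffAt_prod fun i _ => hM _ _)

lemma contDiffAt_matrix_inv (hM : ∀ i j, ContDiffAt ℝ k (fun y => M y i j) x)
    (h0 : (M x).det ≠ 0) (i j : ι) : ContDiffAt ℝ k (fun y => (M y)⁻¹ i j) x := by
  simp only [Matrix.inv_def, Ring.inverse_eq_inv', Matrix.smul_apply, smul_eq_mul,
    Matrix.adjugate_apply]
  refine ((contDiffAt_matrix_det hM).inv h0).mul (contDiffAt_matrix_det fun a b => ?_)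
  by_cases h : a = j
  · subst h; simpa using contDiffAt_const
  · simpa [Matrix.updateRow_apply, h] using hM a b

/-- Jacobi's formula for the derivative of a determinant. -/
lemma fderiv_matrix_det (hM : ∀ i j, DifferentiableAt ℝ (fun y => M y i j) x)
    (h0 : (M x).det ≠ 0) (a : X) :
    fderiv ℝ (fun y => (M y).det) x a =
      (M x).det * ∑ i, ∑ j, (M x)⁻¹ i j * fderiv ℝ (fun y => M y j i) x a := by
  have key : ∀ i (v : ι → ℝ), (Matrix.updateCol (M x) i v).det =
      ∑ σ : Equiv.Perm ι, (Equiv.Perm.sign σ : ℝ) *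
        ((∏ j ∈ Finset.univ.erase i, M x (σ j) j) * v (σ i)) := by
    intro i v
    rw [Matrix.det_apply']
    refine Finset.sum_congr rfl fun σ _ => ?_
    rw [← Finset.prod_erase_mul _ _ (Finset.mem_univ i)]
    congr 2
    · refine Finset.prod_congr rfl fun j hj => ?_
      rw [Matrix.updateCol_apply, if_neg (Finset.ne_of_mem_erase hj)]
    · simp
  have h1 : HasFDerivAt (fun y => (M y).det) (∑ σ : Equiv.Perm ι, (Equiv.Perm.sign σ : ℝ) •
      ∑ i, (∏ j ∈ Finset.univ.erase i, M x (σ j) j) • fderiv ℝ (fun y => M y (σ i) i) x) x := by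
    simp only [Matrix.det_apply']
    refine HasFDerivAt.fun_sum fun σ _ => HasFDerivAt.const_mul ?_ _
    exact HasFDerivAt.finsetProd fun i _ => (hM _ _).hasFDerivAt
  rw [h1.fderiv]
  -- By Cramer's rule, the trace of `M⁻¹ dM` is a sum of determinants with one column replaced.
  have h2 : ∀ i, ∑ j, (M x)⁻¹ i j * fderiv ℝ (fun y => M y j i) x a =
      ((M x).det)⁻¹ * (Matrix.updateCol (M x) i fun j => fderiv ℝ (fun y => M y j i) x a).det := by
    intro i
    rw [← Matrix.cramer_apply, Matrix.cramer_eq_adjugate_mulVec]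
    simp [Matrix.inv_def, Matrix.mulVec, dotProduct, Finset.mul_sum, mul_assoc]
  simp only [h2, ← Finset.mul_sum, mul_inv_cancel_left₀ h0, key]
  simp only [_root_.sum_apply, _root_.smul_apply, smul_eq_mul,
    Finset.mul_sum]
  rw [Finset.sum_comm]

lemma fderiv_matrix_inv (hM : ∀ i j, ContDiffAt ℝ 1 (fun y => M y i j) x)
    (h0 : (M x).det ≠ 0) (i j : ι) (a : X) :
    fderiv ℝ (fun y => (M y)⁻¹ i j) x a =
      -∑ k, ∑ l, (M x)⁻¹ i k * fderiv ℝ (fun y => M y k l) x a * (M x)⁻¹ l j := by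
  have hI := fun i j => (contDiffAt_matrix_inv hM h0 i j).differentiableAt one_ne_zero
  have hM' := fun i j => (hM i j).differentiableAt one_ne_zero
  have hne : ∀ᶠ y in 𝓝 x, (M y).det ≠ 0 :=
    (contDiffAt_matrix_det hM).continuousAt.eventually_ne h0
  -- The derivative of the identity `M * M⁻¹ = 1`, valid near `x`.
  have h1 : ∀ k, ∑ l, ((M x) k l * fderiv ℝ (fun y => (M y)⁻¹ l j) x a +
      (M x)⁻¹ l j * fderiv ℝ (fun y => M y k l) x a) = 0 := by
    intro k
    have e : (fun y => ∑ l, M y k l * (M y)⁻¹ l j) =ᶠ[𝓝 x] fun _ => (1 : Matrix ι ι ℝ) k j := by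
      filter_upwards [hne] with y hy
      rw [← Matrix.mul_apply, Matrix.mul_nonsing_inv _ (isUnit_iff_ne_zero.2 hy)]
    have e2 := e.fderiv_eq (𝕜 := ℝ)
    rw [fderiv_fun_sum fun l _ => (hM' k l).fun_mul (hI l j)] at e2
    simpa [fderiv_fun_mul (hM' _ _) (hI _ _)] using congrArg (fun T => T a) e2
  have h2 : ∑ k, (M x)⁻¹ i k * ∑ l, ((M x) k l * fderiv ℝ (fun y => (M y)⁻¹ l j) x a +
      (M x)⁻¹ l j * fderiv ℝ (fun y => M y k l) x a) = 0 := by simp [h1]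
  simp only [Finset.sum_add_distrib, mul_add] at h2
  have h3 : ∑ k, (M x)⁻¹ i k * ∑ l, (M x) k l * fderiv ℝ (fun y => (M y)⁻¹ l j) x a =
      fderiv ℝ (fun y => (M y)⁻¹ i j) x a := by
    simp only [Finset.mul_sum, ← mul_assoc]
    rw [Finset.sum_comm]
    simp only [← Finset.sum_mul, ← Matrix.mul_apply,
      Matrix.nonsing_inv_mul _ (isUnit_iff_ne_zero.2 h0)]
    simp [Matrix.one_apply]
  rw [h3] at h2
  rw [eq_neg_of_add_eq_zero_left h2]
  simp only [Finset.mul_sum]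
  congr 1
  exact Finset.sum_congr rfl fun k _ => Finset.sum_congr rfl fun l _ => by ring

end MatrixCalculus

namespace GraphMCF

variable {n m : ℕ}

/-! ### Injective linear maps and their Gram matrices -/

/-- The Gram matrix of the images of the coordinate vectors under a linear map. -/
noncomputable def gramOf (L : E n →L[ℝ] Amb n m) : Matrix (Fin n) (Fin n) ℝ :=
  Matrix.of fun i j => inner ℝ (L (ei i)) (L (ei j))

/-- The matrix of a linear endomorphism of `ℝⁿ` in the coordinate basis. -/
noncomputable def matOf (A : E n →L[ℝ] E n) : Matrix (Fin n) (Fin n) ℝ :=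
  Matrix.of fun i j => A (ei j) i

/-- The value of `ω` on the unit `n`-vector of the image of `L`, oriented by `L`:
`ω(L e₁, …, L eₙ) / √det (⟨L eᵢ, L eⱼ⟩)`. It is the junk value `0` if `L` is not injective. -/
noncomputable def unitOmega (L : E n →L[ℝ] Amb n m) : ℝ :=
  omega n m (fun i => L (ei i)) / Real.sqrt (gramOf L).det

/-- For injective `L`, the orthogonal projection onto the range of `L`, followed by the inverse of
`L` on its range: `w ↦ ∑ gᵏˡ ⟨w, L eₗ⟩ eₖ`. -/
noncomputable def tangCoord (L : E n →L[ℝ] Amb n m) : Amb n m →L[ℝ] E n :=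
  ∑ k, ∑ l, (gramOf L)⁻¹ k l • (innerSL ℝ (L (ei l))).smulRight (ei k)

lemma tangCoord_apply (L : E n →L[ℝ] Amb n m) (w : Amb n m) :
    tangCoord L w = ∑ k, ∑ l, ((gramOf L)⁻¹ k l * inner ℝ (L (ei l)) w) • ei k := by
  simp [tangCoord, _root_.sum_apply, smul_smul]

lemma eq_sum_ei (v : E n) : v = ∑ i, v i • ei i := by
  ext j
  simp [ei, Pi.single_apply]

lemma map_eq_sum_ei {V : Type*} [AddCommGroup V] [Module ℝ V] (T : E n →ₗ[ℝ] V) (v : E n) :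
    T v = ∑ i, v i • T (ei i) := by
  conv_lhs => rw [eq_sum_ei v]
  simp

lemma clm_eq_sum_ei {V : Type*} [NormedAddCommGroup V] [NormedSpace ℝ V] (T : E n →L[ℝ] V)
    (v : E n) : T v = ∑ i, v i • T (ei i) := map_eq_sum_ei (T : E n →ₗ[ℝ] V) v

lemma ext_ei {V : Type*} [NormedAddCommGroup V] [NormedSpace ℝ V] {S T : E n →L[ℝ] V}
    (h : ∀ i, S (ei i) = T (ei i)) : S = T := by
  ext1 v
  rw [clm_eq_sum_ei, clm_eq_sum_ei T]
  simp [h]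

lemma linearIndependent_ei : LinearIndependent ℝ (ei : Fin n → E n) := by
  rw [Fintype.linearIndependent_iff]
  intro g hg i
  have := congrArg (fun v : E n => v i) hg
  simpa [ei, Pi.single_apply] using this

lemma gramOf_posDef {L : E n →L[ℝ] Amb n m} (hL : Function.Injective L) : (gramOf L).PosDef := by
  have : LinearIndependent ℝ fun i => L (ei i) :=
    linearIndependent_ei.map' (L : E n →ₗ[ℝ] Amb n m) (LinearMap.ker_eq_bot.2 hL)
  exact Matrix.posDef_gram_of_linearIndependent this

lemma gramOf_det_pos {L : E n →L[ℝ] Amb n m} (hL : Function.Injective L) :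
    0 < (gramOf L).det := (gramOf_posDef hL).det_pos

lemma gramOf_symm (L : E n →L[ℝ] Amb n m) (i j : Fin n) : gramOf L i j = gramOf L j i := by
  simp [gramOf, real_inner_comm]

lemma gramOf_transpose (L : E n →L[ℝ] Amb n m) : (gramOf L)ᵀ = gramOf L := by
  ext i j; exact gramOf_symm L j i

lemma gramOf_inv_symm (L : E n →L[ℝ] Amb n m) (i j : Fin n) :
    (gramOf L)⁻¹ i j = (gramOf L)⁻¹ j i := by
  conv_lhs => rw [← gramOf_transpose, ← Matrix.transpose_nonsing_inv, Matrix.transpose_apply]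

lemma gramOf_inv_mul {L : E n →L[ℝ] Amb n m} (hL : Function.Injective L) (i j : Fin n) :
    ∑ k, (gramOf L)⁻¹ i k * gramOf L k j = (1 : Matrix (Fin n) (Fin n) ℝ) i j := by
  rw [← Matrix.mul_apply, Matrix.nonsing_inv_mul _ (isUnit_iff_ne_zero.2 (gramOf_det_pos hL).ne')]

lemma tangCoord_comp {L : E n →L[ℝ] Amb n m} (hL : Function.Injective L) (v : E n) :
    tangCoord L (L v) = v := by
  suffices h : (tangCoord L).comp L = ContinuousLinearMap.id ℝ (E n) from
    congrArg (fun T => T v) h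
  refine ext_ei fun j => ?_
  simp only [ContinuousLinearMap.comp_apply, tangCoord_apply, ← Finset.sum_smul]
  change ∑ i, (∑ k, (gramOf L)⁻¹ i k * gramOf L k j) • ei i = ei j
  simp [gramOf_inv_mul hL, Matrix.one_apply, ite_smul]

lemma inner_sub_tangCoord {L : E n →L[ℝ] Amb n m} (hL : Function.Injective L) (w : Amb n m)
    (v : E n) : inner ℝ (L v) (w - L (tangCoord L w)) = 0 := by
  suffices h : ∀ j, inner ℝ (L (ei j)) (w - L (tangCoord L w)) = 0 by
    rw [clm_eq_sum_ei, sum_inner]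
    simp [inner_smul_left, h]
  intro j
  rw [inner_sub_right, tangCoord_apply]
  simp only [map_sum, map_smul, inner_sum, inner_smul_right]
  change _ - ∑ k, ∑ l, (gramOf L)⁻¹ k l * inner ℝ (L (ei l)) w * gramOf L j k = 0
  rw [Finset.sum_comm]
  have : ∀ l, ∑ k, (gramOf L)⁻¹ k l * inner ℝ (L (ei l)) w * gramOf L j k =
      (1 : Matrix (Fin n) (Fin n) ℝ) l j * inner ℝ (L (ei l)) w := by
    intro l
    rw [← gramOf_inv_mul hL, Finset.sum_mul]
    refine Finset.sum_congr rfl fun k _ => ?_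
    rw [gramOf_inv_symm L k l, gramOf_symm L j k]; ring
  simp [this, Matrix.one_apply]

lemma normalPart_eq {F : E n → Amb n m} {x : E n} (hF : Function.Injective (fderiv ℝ F x))
    (w : Amb n m) :
    normalPart F x w = w - fderiv ℝ F x (tangCoord (fderiv ℝ F x) w) := by
  rw [normalPart, Submodule.starProjection_orthogonal_val]
  congr 1
  refine Submodule.eq_starProjection_of_mem_of_inner_eq_zero ⟨_, rfl⟩ ?_
  rintro _ ⟨v, rfl⟩
  rw [real_inner_comm]
  exact inner_sub_tangCoord hF w v

/-- The contraction of a bilinear form with the inverse metric is its trace in any basis that `L`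
maps to an orthonormal family. -/
lemma sum_gramOf_inv_eq {L : E n →L[ℝ] Amb n m} {b : Fin n → E n}
    (hb : Orthonormal ℝ fun i => L (b i)) {V : Type*} [AddCommGroup V] [Module ℝ V]
    (Q : E n →ₗ[ℝ] E n →ₗ[ℝ] V) :
    ∑ i, ∑ j, (gramOf L)⁻¹ i j • Q (ei i) (ei j) = ∑ k, Q (b k) (b k) := by
  set A : Matrix (Fin n) (Fin n) ℝ := Matrix.of fun i k => b k i with hA
  have h0 : ∀ k l, inner ℝ (L (b k)) (L (b l)) =
      ∑ i, A i k * ∑ j, gramOf L i j * A j l := by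
    intro k l
    rw [clm_eq_sum_ei L (b k), clm_eq_sum_ei L (b l), sum_inner]
    refine Finset.sum_congr rfl fun i _ => ?_
    rw [inner_sum, Finset.mul_sum]
    refine Finset.sum_congr rfl fun j _ => ?_
    rw [real_inner_smul_left, real_inner_smul_right]
    simp only [gramOf, hA, Matrix.of_apply]
    ring
  have h1 : Aᵀ * (gramOf L * A) = 1 := by
    rw [← Matrix.gram_eq_one_iff_orthonormal.2 hb]
    ext k l
    rw [Matrix.gram_apply, h0]
    rfl
  -- In the matrix form `Aᵀ g A = 1` of orthonormality, the inverse metric is `A Aᵀ`.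
  have h2 : (gramOf L)⁻¹ = A * Aᵀ := by
    refine Matrix.inv_eq_right_inv ?_
    rw [← Matrix.mul_assoc]
    exact mul_eq_one_comm.1 h1
  have h3 : ∀ k, Q (b k) (b k) = ∑ i, ∑ j, (A i k * A j k) • Q (ei i) (ei j) := by
    intro k
    rw [map_eq_sum_ei Q (b k), LinearMap.sum_apply]
    refine Finset.sum_congr rfl fun i _ => ?_
    rw [LinearMap.smul_apply, map_eq_sum_ei (Q (ei i)) (b k), Finset.smul_sum]
    simp [hA, smul_smul]
  simp only [h2, h3, Matrix.mul_apply, Matrix.transpose_apply, Finset.sum_smul]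
  rw [Finset.sum_comm (s := Finset.univ) (t := Finset.univ)
    (f := fun k i => ∑ j, (A i k * A j k) • Q (ei i) (ei j))]
  refine Finset.sum_congr rfl fun i _ => ?_
  rw [Finset.sum_comm]

lemma omega_apply (v : Fin n → Amb n m) :
    omega n m v = (Matrix.of fun i j => v i (Sum.inl j)).det := rfl

lemma continuous_omega : Continuous fun v : Fin n → Amb n m => omega n m v := by
  simp only [omega_apply]
  refine Continuous.matrix_det ?_
  refine continuous_matrix fun i j => ?_
  simp only [Matrix.of_apply]
  fun_prop

lemma hasDerivAt_omega {v : ℝ → Fin n → Amb n m} {v' : Fin n → Amb n m} {s : ℝ}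
    (hv : ∀ i, HasDerivAt (fun s => v s i) (v' i) s) :
    HasDerivAt (fun s => omega n m (v s)) (∑ i, omega n m (Function.update (v s) i (v' i))) s := by
  let f : ContinuousMultilinearMap ℝ (fun _ : Fin n => Amb n m) ℝ :=
    { toMultilinearMap := (omega n m).toMultilinearMap, cont := continuous_omega }
  have h := (HasFDerivAt.multilinear_comp f fun i => (hv i).hasFDerivAt).hasDerivAt
  have e : (∑ i, (f.toContinuousLinearMap (fun j => v s j) i) ∘L
      (ContinuousLinearMap.toSpanSingleton ℝ (v' i))) 1 =
      ∑ i, omega n m (Function.update (v s) i (v' i)) := by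
    simp [_root_.sum_apply, f, ContinuousMultilinearMap.toContinuousLinearMap]
  rw [← e]
  exact h

lemma hasDerivAt_line {V : Type*} [NormedAddCommGroup V] [NormedSpace ℝ V] (L W : V) (s : ℝ) :
    HasDerivAt (fun s : ℝ => L + s • W) W s := by
  simpa using ((hasDerivAt_id s).smul_const W).const_add L

lemma tendsto_line {V : Type*} [NormedAddCommGroup V] [NormedSpace ℝ V] (L W : V) :
    Filter.Tendsto (fun s : ℝ => L + s • W) (𝓝 0) (𝓝 L) := by
  simpa using (hasDerivAt_line L W 0).continuousAt.tendsto

lemma _root_.HasFDerivAt.hasDerivAt_line {V V' : Type*} [NormedAddCommGroup V] [NormedSpace ℝ V]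
    [NormedAddCommGroup V'] [NormedSpace ℝ V'] {f : V → V'} {f' : V →L[ℝ] V'} {L : V}
    (hf : HasFDerivAt f f' L) (W : V) : HasDerivAt (fun s : ℝ => f (L + s • W)) (f' W) 0 := by
  have h : HasFDerivAt f f' (L + (0 : ℝ) • W) := by simpa using hf
  exact h.comp_hasDerivAt (0 : ℝ) (GraphMCF.hasDerivAt_line L W 0)

/-! ### Invariance of `unitOmega` under reparametrization -/

lemma comp_ei (L : E n →L[ℝ] Amb n m) (A : E n →L[ℝ] E n) (i : Fin n) :
    L (A (ei i)) = ∑ j, matOf A j i • L (ei j) := clm_eq_sum_ei L _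

lemma gramOf_comp (L : E n →L[ℝ] Amb n m) (A : E n →L[ℝ] E n) :
    gramOf (L.comp A) = (matOf A)ᵀ * (gramOf L * matOf A) := by
  ext k l
  simp only [gramOf, Matrix.of_apply, ContinuousLinearMap.comp_apply]
  rw [comp_ei, comp_ei, sum_inner, Matrix.mul_apply]
  refine Finset.sum_congr rfl fun i _ => ?_
  rw [inner_sum, Matrix.mul_apply, Finset.mul_sum]
  refine Finset.sum_congr rfl fun j _ => ?_
  rw [real_inner_smul_left, real_inner_smul_right]
  simp only [Matrix.of_apply, Matrix.transpose_apply]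
  ring

lemma omega_comp (L : E n →L[ℝ] Amb n m) (A : E n →L[ℝ] E n) :
    omega n m (fun i => L (A (ei i))) = (matOf A).det * omega n m fun i => L (ei i) := by
  rw [omega_apply, omega_apply, ← Matrix.det_transpose (matOf A), ← Matrix.det_mul]
  congr 1
  ext i k
  simp only [Matrix.of_apply, Matrix.mul_apply, Matrix.transpose_apply]
  rw [comp_ei]
  simp

/-- A change of parameters changes `unitOmega` by the sign of its determinant; both sides are `0`
if the determinant vanishes. -/
lemma unitOmega_comp (L : E n →L[ℝ] Amb n m) (A : E n →L[ℝ] E n) :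
    unitOmega (L.comp A) = (matOf A).det / |(matOf A).det| * unitOmega L := by
  have h : (gramOf (L.comp A)).det = (matOf A).det ^ 2 * (gramOf L).det := by
    rw [gramOf_comp, Matrix.det_mul, Matrix.det_mul, Matrix.det_transpose]; ring
  simp only [unitOmega, h, Real.sqrt_mul (sq_nonneg _), Real.sqrt_sq_eq_abs,
    ContinuousLinearMap.comp_apply, omega_comp]
  rw [mul_div_mul_comm]

lemma unitOmega_comp_of_pos (L : E n →L[ℝ] Amb n m) {A : E n →L[ℝ] E n}
    (hA : 0 < (matOf A).det) : unitOmega (L.comp A) = unitOmega L := by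
  rw [unitOmega_comp, abs_of_pos hA, div_self hA.ne', one_mul]

lemma matOf_id_add_smul (C : E n →L[ℝ] E n) (s : ℝ) :
    matOf (ContinuousLinearMap.id ℝ (E n) + s • C) = 1 + s • matOf C := by
  ext i j
  simp [matOf, ei, Matrix.one_apply]

lemma eventually_det_id_add_smul_pos (C : E n →L[ℝ] E n) :
    ∀ᶠ s : ℝ in 𝓝 0, 0 < (matOf (ContinuousLinearMap.id ℝ (E n) + s • C)).det := by
  have hc : Continuous fun s : ℝ => (1 + s • matOf C).det :=
    Continuous.matrix_det (by fun_prop)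
  simp only [matOf_id_add_smul]
  exact hc.continuousAt.eventually (lt_mem_nhds (by simp))

lemma contDiff_gramOf (i j : Fin n) :
    ContDiff ℝ 2 fun L : E n →L[ℝ] Amb n m => gramOf L i j := by
  simp only [gramOf, Matrix.of_apply]
  exact ContDiff.inner ℝ (by fun_prop) (by fun_prop)

lemma contDiffAt_unitOmega {L : E n →L[ℝ] Amb n m} (hL : Function.Injective L) :
    ContDiffAt ℝ 2 (unitOmega : (E n →L[ℝ] Amb n m) → ℝ) L := by
  have hg : 0 < (gramOf L).det := gramOf_det_pos hL
  refine ContDiffAt.div ?_ ?_ (Real.sqrt_pos.2 hg).ne'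
  · simp only [omega_apply]
    refine contDiffAt_matrix_det fun i j => ContDiff.contDiffAt ?_
    simp only [Matrix.of_apply]
    fun_prop
  · exact (contDiffAt_matrix_det fun i j => (contDiff_gramOf i j).contDiffAt).sqrt hg.ne'

/-- The invariance of `unitOmega`, differentiated in `L`. -/
lemma fderiv_unitOmega_comp {L W : E n →L[ℝ] Amb n m} {A : E n →L[ℝ] E n}
    (hA : 0 < (matOf A).det) (hLA : Function.Injective (L.comp A)) :
    fderiv ℝ unitOmega (L.comp A) (W.comp A) = fderiv ℝ unitOmega L W := by
  let R : (E n →L[ℝ] Amb n m) →L[ℝ] (E n →L[ℝ] Amb n m) :=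
    (ContinuousLinearMap.compL ℝ (E n) (E n) (Amb n m)).flip A
  have h1 : (fun M : E n →L[ℝ] Amb n m => unitOmega (R M)) = unitOmega := by
    funext M
    exact unitOmega_comp_of_pos M hA
  have h2 : HasFDerivAt unitOmega (fderiv ℝ unitOmega (L.comp A)) (R L) :=
    ((contDiffAt_unitOmega hLA).differentiableAt two_ne_zero).hasFDerivAt
  have h3 := (h2.comp L R.hasFDerivAt).fderiv
  rw [show unitOmega ∘ R = (unitOmega : (E n →L[ℝ] Amb n m) → ℝ) from h1] at h3
  rw [h3]
  rfl

lemma eventually_injective {L : E n →L[ℝ] Amb n m} (hL : Function.Injective L) :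
    ∀ᶠ M : E n →L[ℝ] Amb n m in 𝓝 L, Function.Injective M :=
  ContinuousLinearMap.isOpen_injective.mem_nhds hL

/-- `unitOmega` does not change to first order when `L` is changed within its range. -/
lemma fderiv_unitOmega_self_comp {L : E n →L[ℝ] Amb n m} (hL : Function.Injective L)
    (C : E n →L[ℝ] E n) : fderiv ℝ unitOmega L (L.comp C) = 0 := by
  have h3 := ((contDiffAt_unitOmega hL).differentiableAt two_ne_zero).hasFDerivAt.hasDerivAt_line
    (L.comp C)
  have h4 : (fun s : ℝ => unitOmega (L + s • L.comp C)) =ᶠ[𝓝 0] fun _ => unitOmega L := by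
    filter_upwards [eventually_det_id_add_smul_pos C] with s hs
    rw [← unitOmega_comp_of_pos L hs]
    congr 1
    ext1 v
    simp
  exact h3.unique ((hasDerivAt_const _ _).congr_of_eventuallyEq h4)

lemma differentiableAt_fderiv_unitOmega {L : E n →L[ℝ] Amb n m} (hL : Function.Injective L) :
    DifferentiableAt ℝ (fderiv ℝ (unitOmega : (E n →L[ℝ] Amb n m) → ℝ)) L :=
  ((contDiffAt_unitOmega hL).fderiv_right (m := 1) (by norm_num)).differentiableAt one_ne_zero

lemma clm_apply_line {V V' : Type*} [NormedAddCommGroup V] [NormedSpace ℝ V]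
    [NormedAddCommGroup V'] [NormedSpace ℝ V'] {f : V → V →L[ℝ] V'} {f' : V →L[ℝ] V →L[ℝ] V'}
    {L : V} (hf : HasFDerivAt f f' L) (W U U' : V) :
    HasDerivAt (fun s : ℝ => f (L + s • W) (U + s • U')) (f' W U + f L U') 0 := by
  simpa using (hf.hasDerivAt_line W).clm_apply (hasDerivAt_line U U' 0)

lemma clm_apply_line_const {V V' : Type*} [NormedAddCommGroup V] [NormedSpace ℝ V]
    [NormedAddCommGroup V'] [NormedSpace ℝ V'] {f : V → V →L[ℝ] V'} {f' : V →L[ℝ] V →L[ℝ] V'}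
    {L : V} (hf : HasFDerivAt f f' L) (W U : V) :
    HasDerivAt (fun s : ℝ => f (L + s • W) U) (f' W U) 0 := by
  simpa using clm_apply_line hf W U 0

/-- A variation of `L` within its range acts on the first derivative of `unitOmega` like a change of
parameters. -/
lemma fderiv_fderiv_unitOmega_self_comp {L : E n →L[ℝ] Amb n m} (hL : Function.Injective L)
    (C : E n →L[ℝ] E n) (W : E n →L[ℝ] Amb n m) :
    fderiv ℝ (fderiv ℝ unitOmega) L (L.comp C) W = -fderiv ℝ unitOmega L (W.comp C) := by
  have h3 := clm_apply_line (differentiableAt_fderiv_unitOmega hL).hasFDerivAt (L.comp C) W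
    (W.comp C)
  -- Along the reparametrizations `1 + s C`, the derivative of `unitOmega` is constant.
  have h4 : (fun s : ℝ => fderiv ℝ unitOmega (L + s • L.comp C) (W + s • W.comp C)) =ᶠ[𝓝 0]
      fun _ => fderiv ℝ unitOmega L W := by
    filter_upwards [eventually_det_id_add_smul_pos C,
      (tendsto_line L (L.comp C)).eventually (eventually_injective hL)] with s hs hi
    have e : ∀ W : E n →L[ℝ] Amb n m,
        W + s • W.comp C = W.comp (ContinuousLinearMap.id ℝ (E n) + s • C) := by
      intro W; ext1 v; simp
    rw [e] at hi
    rw [e, e, fderiv_unitOmega_comp hs hi]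
  exact eq_neg_of_add_eq_zero_left
    (h3.unique ((hasDerivAt_const _ _).congr_of_eventuallyEq h4))

/-! ### The Hessian of `unitOmega` -/

lemma deriv_deriv_unitOmega_line {L : E n →L[ℝ] Amb n m} (hL : Function.Injective L)
    (W : E n →L[ℝ] Amb n m) :
    deriv (deriv fun s : ℝ => unitOmega (L + s • W)) 0 =
      fderiv ℝ (fderiv ℝ unitOmega) L W W := by
  have h2 : deriv (fun s : ℝ => unitOmega (L + s • W)) =ᶠ[𝓝 0]
      fun s => fderiv ℝ unitOmega (L + s • W) W := by
    filter_upwards [(tendsto_line L W).eventually (eventually_injective hL)] with s hs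
    exact (((contDiffAt_unitOmega hs).differentiableAt two_ne_zero).hasFDerivAt.comp_hasDerivAt s
      (hasDerivAt_line L W s)).deriv
  rw [h2.deriv_eq]
  exact (clm_apply_line_const (differentiableAt_fderiv_unitOmega hL).hasFDerivAt W W).deriv

end GraphMCF

lemma deriv_deriv_mul {f f₁ g g₁ : ℝ → ℝ} {a b x : ℝ} (hf : ∀ᶠ s in 𝓝 x, HasDerivAt f (f₁ s) s)
    (hf₁ : HasDerivAt f₁ a x) (hg : ∀ᶠ s in 𝓝 x, HasDerivAt g (g₁ s) s)
    (hg₁ : HasDerivAt g₁ b x) :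
    deriv (deriv fun s => f s * g s) x = a * g x + 2 * f₁ x * g₁ x + f x * b := by
  have h : deriv (fun s => f s * g s) =ᶠ[𝓝 x] fun s => f₁ s * g s + f s * g₁ s := by
    filter_upwards [hf, hg] with s h1 h2
    exact (h1.mul h2).deriv
  rw [h.deriv_eq, ((hf₁.fun_mul hg.self_of_nhds).fun_add (hf.self_of_nhds.fun_mul hg₁)).deriv]
  ring

/-- The function `s ↦ det (1 + s² M) ^ (-1/2)` has first derivative `0` and second derivative
`-tr M` at `0`. -/
lemma exists_deriv_inv_sqrt_det {ι : Type*} [Fintype ι] [DecidableEq ι] (M : Matrix ι ι ℝ) :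
    ∃ g₁ : ℝ → ℝ, g₁ 0 = 0 ∧ HasDerivAt g₁ (-M.trace) 0 ∧
      ∀ᶠ s in 𝓝 (0 : ℝ), HasDerivAt (fun s : ℝ => (√(1 + s ^ 2 • M).det)⁻¹) (g₁ s) s := by
  obtain ⟨q, hq⟩ : ∃ q : Polynomial ℝ, ∀ r : ℝ,
      (1 + r • M).det = 1 + M.trace * r + q.eval r * r ^ 2 :=
    ⟨_, fun r => Matrix.det_one_add_smul r M⟩
  set P : ℝ → ℝ := fun s => 1 + M.trace * s ^ 2 + q.eval (s ^ 2) * s ^ 4 with hP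
  set P₁ : ℝ → ℝ := fun s => 2 * M.trace * s +
    (q.derivative.eval (s ^ 2) * (2 * s) * s ^ 4 + q.eval (s ^ 2) * (4 * s ^ 3)) with hP₁
  have hdet : ∀ s : ℝ, (1 + s ^ 2 • M).det = P s := by
    intro s; rw [hq]; simp only [hP]; ring
  have hsq : ∀ s : ℝ, HasDerivAt (fun s : ℝ => s ^ 2) (2 * s) s := fun s => by
    simpa using hasDerivAt_pow 2 s
  have hqs : ∀ (q : Polynomial ℝ) (s : ℝ), HasDerivAt (fun s : ℝ => q.eval (s ^ 2))
      (q.derivative.eval (s ^ 2) * (2 * s)) s := fun q s =>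
    HasDerivAt.comp (h₂ := fun r => q.eval r) s (q.hasDerivAt (s ^ 2)) (hsq s)
  have h4 : ∀ s : ℝ, HasDerivAt (fun s : ℝ => s ^ 4) (4 * s ^ 3) s := fun s => by
    simpa using hasDerivAt_pow 4 s
  have hd : ∀ s, HasDerivAt P (P₁ s) s := by
    intro s
    refine ((((hsq s).const_mul M.trace).const_add 1).add ((hqs q s).mul (h4 s))).congr_deriv ?_
    simp only [hP₁]; ring
  have hd₁ : HasDerivAt P₁ (2 * M.trace) 0 := by
    have h3 : HasDerivAt (fun s : ℝ => 4 * s ^ 3) (4 * (3 * 0 ^ 2)) 0 := by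
      simpa using (hasDerivAt_pow 3 (0 : ℝ)).const_mul 4
    have h1 : HasDerivAt (fun s : ℝ => 2 * s) 2 0 := by
      simpa using (hasDerivAt_id (0 : ℝ)).const_mul 2
    have hl : HasDerivAt (fun s : ℝ => 2 * M.trace * s) (2 * M.trace) 0 := by
      simpa using (hasDerivAt_id (0 : ℝ)).const_mul (2 * M.trace)
    refine (hl.add ((((hqs q.derivative 0).mul h1).mul (h4 0)).add
      ((hqs q 0).mul h3))).congr_deriv ?_
    simp
  have hP0 : P 0 = 1 := by simp [hP]
  have hP₁0 : P₁ 0 = 0 := by simp [hP₁]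
  have hpos : ∀ᶠ s in 𝓝 (0 : ℝ), 0 < P s :=
    (hd 0).continuousAt.eventually (lt_mem_nhds (by rw [hP0]; exact one_pos))
  have hr : ∀ s, 0 < P s → HasDerivAt (fun s => (√(P s))⁻¹)
      (P₁ s * -((1 / (2 * √(P s))) / √(P s) ^ 2)) s := by
    intro s hs
    refine ((hd s).sqrt hs.ne' |>.fun_inv (Real.sqrt_pos.2 hs).ne').congr_deriv ?_
    ring
  refine ⟨fun s => P₁ s * -((1 / (2 * √(P s))) / √(P s) ^ 2), by simp [hP₁0], ?_, ?_⟩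
  · have hs : HasDerivAt (fun s => √(P s)) 0 0 := by
      simpa [hP₁0] using (hd 0).sqrt (by simp [hP0])
    have h := hd₁.mul (((hasDerivAt_const (0 : ℝ) (1 : ℝ)).div (hs.const_mul 2) (by simp [hP0])).div
      (hs.pow 2) (by simp [hP0])).neg
    refine h.congr_deriv ?_
    simp [hP0, hP₁0]
    ring
  · simp only [hdet]
    filter_upwards [hpos] with s hs using hr s hs

namespace GraphMCF

variable {n m : ℕ}

/-- The second derivative of `unitOmega` in a direction normal to the range of `L`. -/
lemma deriv_deriv_unitOmega_normal {L W : E n →L[ℝ] Amb n m}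
    (hL : Orthonormal ℝ fun i => L (ei i)) (hW : ∀ i j, inner ℝ (L (ei i)) (W (ei j)) = 0) :
    deriv (deriv fun s : ℝ => unitOmega (L + s • W)) 0 =
      (∑ i, ∑ j ∈ Finset.univ.erase i, omega n m (Function.update (Function.update
        (fun k => L (ei k)) i (W (ei i))) j (W (ei j)))) -
      omega n m (fun i => L (ei i)) * ∑ i, ‖W (ei i)‖ ^ 2 := by
  obtain ⟨g₁, h0, h1, h2⟩ := exists_deriv_inv_sqrt_det (gramOf W)
  -- The Gram matrix has no term of first order in `s`, as `W` is normal.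
  have hgram : ∀ s : ℝ, gramOf (L + s • W) = 1 + s ^ 2 • gramOf W := by
    intro s
    have h := Matrix.gram_eq_one_iff_orthonormal.2 hL
    ext i j
    have hij := congrFun (congrFun h i) j
    rw [Matrix.gram_apply] at hij
    have hW' : inner ℝ (W (ei i)) (L (ei j)) = 0 := by rw [real_inner_comm]; exact hW j i
    simp only [gramOf, Matrix.of_apply, Matrix.add_apply, Matrix.smul_apply, smul_eq_mul,
      _root_.add_apply, _root_.smul_apply, inner_add_left, inner_add_right,
      real_inner_smul_left, real_inner_smul_right, hW, hW', hij]
    ring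
  set N : ℝ → ℝ := fun s => omega n m fun i => L (ei i) + s • W (ei i) with hN
  set N₁ : ℝ → ℝ := fun s => ∑ i, omega n m
    (Function.update (fun k => L (ei k) + s • W (ei k)) i (W (ei i))) with hN₁
  have hline : ∀ i s, HasDerivAt (fun s : ℝ => L (ei i) + s • W (ei i)) (W (ei i)) s :=
    fun i s => hasDerivAt_line _ _ s
  have hNd : ∀ s, HasDerivAt N (N₁ s) s := fun s => hasDerivAt_omega fun i => hline i s
  have hN₁d : HasDerivAt N₁ (∑ i, ∑ j ∈ Finset.univ.erase i, omega n m (Function.update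
      (Function.update (fun k => L (ei k)) i (W (ei i))) j (W (ei j)))) 0 := by
    refine HasDerivAt.fun_sum fun i _ => ?_
    have h : ∀ j, HasDerivAt
        (fun s : ℝ => Function.update (fun k => L (ei k) + s • W (ei k)) i (W (ei i)) j)
        (if j = i then 0 else W (ei j)) 0 := by
      intro j
      by_cases hj : j = i
      · subst hj; simpa using hasDerivAt_const _ _
      · simpa [hj] using hline j 0
    refine (hasDerivAt_omega h).congr_deriv ?_
    rw [← Finset.add_sum_erase _ _ (Finset.mem_univ i)]
    simp only [if_true, AlternatingMap.map_update_zero, zero_add, zero_smul, add_zero]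
    exact Finset.sum_congr rfl fun j hj => by rw [if_neg (Finset.ne_of_mem_erase hj)]
  have e : (fun s : ℝ => unitOmega (L + s • W)) =
      fun s => N s * (√(1 + s ^ 2 • gramOf W).det)⁻¹ := by
    funext s
    rw [unitOmega, hgram, div_eq_mul_inv]
    rfl
  rw [e, deriv_deriv_mul (Filter.Eventually.of_forall hNd) hN₁d h2 h1, h0]
  have ht : (gramOf W).trace = ∑ i, ‖W (ei i)‖ ^ 2 := by
    simp [Matrix.trace, gramOf]
  rw [ht]
  simp [hN]
  ring

/-- The linear endomorphism of `ℝⁿ` that maps the coordinate basis to `b`. -/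
noncomputable def ofBasis (b : Fin n → E n) : E n →L[ℝ] E n :=
  ∑ i, (EuclideanSpace.proj i).smulRight (b i)

lemma ofBasis_ei (b : Fin n → E n) (i : Fin n) : ofBasis b (ei i) = b i := by
  simp [ofBasis, ei, _root_.sum_apply, ite_smul]

/-- The determinant of a family of `n` vectors of `ℝⁿ`. -/
noncomputable def detOf (b : Fin n → E n) : ℝ := (Matrix.of fun i j => b j i).det

lemma detOf_eq (b : Fin n → E n) : (matOf (ofBasis b)).det = detOf b := by
  simp [matOf, detOf, ofBasis_ei]

lemma gramOf_comp_ofBasis {L : E n →L[ℝ] Amb n m} {b : Fin n → E n}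
    (hb : Orthonormal ℝ fun i => L (b i)) : gramOf (L.comp (ofBasis b)) = 1 := by
  rw [← Matrix.gram_eq_one_iff_orthonormal.2 hb]
  ext i j
  simp [gramOf, ofBasis_ei]

lemma detOf_ne_zero {L : E n →L[ℝ] Amb n m} {b : Fin n → E n}
    (hb : Orthonormal ℝ fun i => L (b i)) : detOf b ≠ 0 := by
  intro h
  have h1 := congrArg Matrix.det (gramOf_comp_ofBasis hb)
  rw [gramOf_comp, Matrix.det_mul, Matrix.det_mul, detOf_eq, h] at h1
  simp at h1

/-- For an orthonormal frame `L bᵢ`, `ω(L b₁, …, L bₙ)` is `unitOmega L` up to the orientation of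
`b`. -/
lemma omega_orthonormal {L : E n →L[ℝ] Amb n m} {b : Fin n → E n}
    (hb : Orthonormal ℝ fun i => L (b i)) :
    omega n m (fun i => L (b i)) = detOf b / |detOf b| * unitOmega L := by
  rw [← detOf_eq, ← unitOmega_comp, unitOmega, gramOf_comp_ofBasis hb]
  simp [ofBasis_ei]

/-- The Hessian of `unitOmega` in a direction `W` normal to the range of `L`, in terms of a basis
`b` that `L` maps to an orthonormal family. -/
lemma fderiv_fderiv_unitOmega_normal {L W : E n →L[ℝ] Amb n m} {b : Fin n → E n}
    (hL : Function.Injective L) (hb : Orthonormal ℝ fun i => L (b i))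
    (hW : ∀ u v, inner ℝ (L u) (W v) = 0) :
    detOf b / |detOf b| * fderiv ℝ (fderiv ℝ unitOmega) L W W =
      (∑ i, ∑ j ∈ Finset.univ.erase i,
        omega n m (Function.update (Function.update (fun k => L (b k)) i (W (b i))) j (W (b j)))) -
      omega n m (fun i => L (b i)) * ∑ i, ‖W (b i)‖ ^ 2 := by
  have e : (fun s : ℝ => unitOmega (L.comp (ofBasis b) + s • W.comp (ofBasis b))) =
      fun s => detOf b / |detOf b| * unitOmega (L + s • W) := by
    funext s
    rw [← detOf_eq, ← unitOmega_comp]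
    congr 1
  have h := deriv_deriv_unitOmega_normal (L := L.comp (ofBasis b)) (W := W.comp (ofBasis b))
    (by simpa [ofBasis_ei] using hb) (fun i j => hW _ _)
  rw [e, deriv_const_mul_field', deriv_const_mul_field, deriv_deriv_unitOmega_line hL] at h
  simpa only [ContinuousLinearMap.comp_apply, ofBasis_ei] using h

end GraphMCF

/-! ### Second derivatives -/

section SecondDerivative

variable {X Y Z : Type*} [NormedAddCommGroup X] [NormedSpace ℝ X] [NormedAddCommGroup Y]
  [NormedSpace ℝ Y] [NormedAddCommGroup Z] [NormedSpace ℝ Z]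

lemma ContDiffAt.snd_fderiv_symm {f : X → Y} {x : X} (hf : ContDiffAt ℝ 2 f x) (a b : X) :
    fderiv ℝ (fderiv ℝ f) x a b = fderiv ℝ (fderiv ℝ f) x b a :=
  (hf.isSymmSndFDerivAt (by simp)).eq a b

lemma ContDiffAt.differentiableAt_fderiv {f : X → Y} {x : X} (hf : ContDiffAt ℝ 2 f x) :
    DifferentiableAt ℝ (fderiv ℝ f) x :=
  (hf.fderiv_right (m := 1) (by norm_num)).differentiableAt one_ne_zero

lemma ContDiffAt.eventually_differentiableAt {f : X → Y} {x : X} (hf : ContDiffAt ℝ 2 f x) :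
    ∀ᶠ y in 𝓝 x, DifferentiableAt ℝ f y :=
  (hf.eventually (by simp)).mono fun _ h => h.differentiableAt two_ne_zero

lemma fderiv_fderiv_apply {f : X → Y →L[ℝ] Z} {x : X} (hf : DifferentiableAt ℝ f x) (a : X)
    (b : Y) : fderiv ℝ (fun y => f y b) x a = fderiv ℝ f x a b := by
  rw [fderiv_clm_apply hf (differentiableAt_const b)]
  simp

/-- The chain rule for second derivatives. -/
lemma fderiv_fderiv_comp {φ : Y → Z} {f : X → Y} {x : X} (hφ : ContDiffAt ℝ 2 φ (f x))
    (hf : ContDiffAt ℝ 2 f x) (a b : X) :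
    fderiv ℝ (fderiv ℝ fun y => φ (f y)) x a b =
      fderiv ℝ (fderiv ℝ φ) (f x) (fderiv ℝ f x a) (fderiv ℝ f x b) +
        fderiv ℝ φ (f x) (fderiv ℝ (fderiv ℝ f) x a b) := by
  have h1 : fderiv ℝ (fun y => φ (f y)) =ᶠ[𝓝 x]
      fun y => (fderiv ℝ φ (f y)).comp (fderiv ℝ f y) := by
    filter_upwards [hf.eventually_differentiableAt,
      hf.continuousAt.eventually hφ.eventually_differentiableAt] with y h1 h2
    exact fderiv_comp y h2 h1
  have h2 : HasFDerivAt (fun y => fderiv ℝ φ (f y))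
      ((fderiv ℝ (fderiv ℝ φ) (f x)).comp (fderiv ℝ f x)) x :=
    HasFDerivAt.comp (g := fderiv ℝ φ) x hφ.differentiableAt_fderiv.hasFDerivAt
      (hf.differentiableAt two_ne_zero).hasFDerivAt
  rw [h1.fderiv_eq, (h2.clm_comp hf.differentiableAt_fderiv.hasFDerivAt).fderiv]
  simp [add_comm]

end SecondDerivative

namespace GraphMCF

variable {n m : ℕ}

/-! ### The Laplacian in terms of Christoffel symbols -/

/-- The Christoffel symbols: for an immersion `G`, the vector `christoffel G x a b` of `ℝⁿ` holds
the coordinates of the tangential part of `D²G(a, b)` in the basis `∂ᵢG`. -/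
noncomputable def christoffel (G : E n → Amb n m) (x a : E n) : E n →L[ℝ] E n :=
  (tangCoord (fderiv ℝ G x)).comp (fderiv ℝ (fderiv ℝ G) x a)

variable {G : E n → Amb n m} {x : E n}

lemma contDiffAt_fderiv (hG : ContDiffAt ℝ 3 G x) : ContDiffAt ℝ 2 (fderiv ℝ G) x :=
  hG.fderiv_right (by norm_num)

lemma contDiffAt_metric (hG : ContDiffAt ℝ 3 G x) (i j : Fin n) :
    ContDiffAt ℝ 2 (fun y => metric G y i j) x :=
  (contDiff_gramOf i j).contDiffAt.comp x (contDiffAt_fderiv hG)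

lemma fderiv_metric (hG : ContDiffAt ℝ 3 G x) (i j : Fin n) (a : E n) :
    fderiv ℝ (fun y => metric G y i j) x a =
      inner ℝ (fderiv ℝ G x (ei i)) (fderiv ℝ (fderiv ℝ G) x a (ei j)) +
      inner ℝ (fderiv ℝ (fderiv ℝ G) x a (ei i)) (fderiv ℝ G x (ei j)) := by
  have h : ∀ i, HasFDerivAt (fun y => fderiv ℝ G y (ei i))
      ((fderiv ℝ (fderiv ℝ G) x).flip (ei i)) x := by
    intro i
    have := ((contDiffAt_fderiv hG).differentiableAt two_ne_zero).hasFDerivAt.clm_apply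
      (hasFDerivAt_const (ei i) x)
    simpa using this
  simp only [metric, Matrix.of_apply, tang]
  rw [((h i).inner ℝ (h j)).fderiv]
  simp

lemma tangCoord_coord (L : E n →L[ℝ] Amb n m) (w : Amb n m) (k : Fin n) :
    tangCoord L w k = ∑ l, (gramOf L)⁻¹ k l * inner ℝ (L (ei l)) w := by
  rw [tangCoord_apply]
  simp [← Finset.sum_smul, ei, Pi.single_apply]

lemma metric_det_pos (hinj : Function.Injective (fderiv ℝ G x)) : 0 < (metric G x).det :=
  gramOf_det_pos hinj

lemma metricInv_symm (G : E n → Amb n m) (x : E n) (i j : Fin n) :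
    metricInv G x i j = metricInv G x j i := gramOf_inv_symm _ i j

lemma contDiffAt_metricInv (hG : ContDiffAt ℝ 3 G x) (hinj : Function.Injective (fderiv ℝ G x))
    (i j : Fin n) : ContDiffAt ℝ 2 (fun y => metricInv G y i j) x :=
  contDiffAt_matrix_inv (contDiffAt_metric hG) (metric_det_pos hinj).ne' i j

lemma christoffel_coord (a b : E n) (k : Fin n) : christoffel G x a b k =
    ∑ l, metricInv G x k l * inner ℝ (fderiv ℝ G x (ei l)) (fderiv ℝ (fderiv ℝ G) x a b) :=
  tangCoord_coord _ _ k

lemma christoffel_symm (hG : ContDiffAt ℝ 3 G x) (a b : E n) :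
    christoffel G x a b = christoffel G x b a := by
  simp only [christoffel, ContinuousLinearMap.comp_apply]
  rw [(hG.of_le (by norm_num)).snd_fderiv_symm]

/-- `∂ₐ gⁱʲ = -(gˡʲ Γⁱₐₗ + gⁱˡ Γʲₐₗ)`. -/
lemma fderiv_metricInv (hG : ContDiffAt ℝ 3 G x) (hinj : Function.Injective (fderiv ℝ G x))
    (i j : Fin n) (a : E n) :
    fderiv ℝ (fun y => metricInv G y i j) x a =
      -(∑ l, metricInv G x l j * christoffel G x a (ei l) i +
        ∑ l, metricInv G x i l * christoffel G x a (ei l) j) := by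
  have h := fderiv_matrix_inv (M := metric G) (x := x)
    (fun i j => (contDiffAt_metric hG i j).of_le (by norm_num)) (metric_det_pos hinj).ne' i j a
  rw [show (fun y => metricInv G y i j) = fun y => (metric G y)⁻¹ i j from rfl, h]
  simp only [fderiv_metric hG, christoffel_coord, mul_add, add_mul, Finset.sum_add_distrib,
    Finset.mul_sum]
  congr 2
  · rw [Finset.sum_comm]
    refine Finset.sum_congr rfl fun l _ => Finset.sum_congr rfl fun k _ => ?_
    change metricInv G x i k * _ * metricInv G x l j = _
    ring
  · refine Finset.sum_congr rfl fun l _ => Finset.sum_congr rfl fun k _ => ?_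
    change metricInv G x i l * _ * metricInv G x k j = _
    rw [metricInv_symm G x k j, real_inner_comm]
    ring

/-- `Δ f = gⁱʲ (∂ᵢ∂ⱼ f - Γᵏᵢⱼ ∂ₖ f)`. -/
lemma laplacian_eq (hG : ContDiffAt ℝ 3 G x) (hinj : Function.Injective (fderiv ℝ G x))
    {f : E n → ℝ} (hf : ContDiffAt ℝ 2 f x) :
    laplacian G f x = ∑ i, ∑ j, metricInv G x i j *
      (fderiv ℝ (fderiv ℝ f) x (ei i) (ei j) - fderiv ℝ f x (christoffel G x (ei i) (ei j))) := by
  have hpos := metric_det_pos hinj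
  have hs : 0 < √(metric G x).det := Real.sqrt_pos.2 hpos
  have hM : ∀ i j, DifferentiableAt ℝ (fun y => metric G y i j) x := fun i j =>
    (contDiffAt_metric hG i j).differentiableAt two_ne_zero
  have hI : ∀ i j, DifferentiableAt ℝ (fun y => metricInv G y i j) x := fun i j =>
    (contDiffAt_metricInv hG hinj i j).differentiableAt two_ne_zero
  have hdet : DifferentiableAt ℝ (fun y => (metric G y).det) x :=
    (contDiffAt_matrix_det (contDiffAt_metric hG)).differentiableAt two_ne_zero
  have hfj : ∀ j, DifferentiableAt ℝ (fun y => fderiv ℝ f y (ei j)) x := fun j =>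
    hf.differentiableAt_fderiv.clm_apply (differentiableAt_const _)
  have htr : ∀ i, fderiv ℝ (fun y => √(metric G y).det) x (ei i) =
      √(metric G x).det * ∑ l, christoffel G x (ei i) (ei l) l := by
    intro i
    rw [fderiv_sqrt hdet hpos.ne', _root_.smul_apply,
      fderiv_matrix_det hM hpos.ne']
    have h : ∑ k, ∑ l, (metric G x)⁻¹ k l * fderiv ℝ (fun y => metric G y l k) x (ei i) =
        2 * ∑ l, christoffel G x (ei i) (ei l) l := by
      simp only [fderiv_metric hG, mul_add, Finset.sum_add_distrib, christoffel_coord, two_mul]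
      congr 1
      rw [Finset.sum_comm]
      refine Finset.sum_congr rfl fun l _ => Finset.sum_congr rfl fun k _ => ?_
      rw [real_inner_comm]
      congr 1
      exact metricInv_symm G x _ _
    rw [h, smul_eq_mul]
    field_simp
    rw [Real.sq_sqrt hpos.le]
  have hterm : ∀ i, fderiv ℝ (fun y => √(metric G y).det *
      ∑ j, metricInv G y i j * fderiv ℝ f y (ei j)) x (ei i) = √(metric G x).det *
      ((∑ l, christoffel G x (ei i) (ei l) l) * (∑ j, metricInv G x i j * fderiv ℝ f x (ei j)) +
        ∑ j, (metricInv G x i j * fderiv ℝ (fderiv ℝ f) x (ei i) (ei j) +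
          fderiv ℝ f x (ei j) * fderiv ℝ (fun y => metricInv G y i j) x (ei i))) := by
    intro i
    have hd : ∀ j, DifferentiableAt ℝ (fun y => metricInv G y i j * fderiv ℝ f y (ei j)) x :=
      fun j => (hI i j).mul (hfj j)
    rw [fderiv_fun_mul (hdet.sqrt hpos.ne') (DifferentiableAt.fun_sum fun j _ => hd j),
      fderiv_fun_sum fun j _ => hd j]
    simp only [_root_.add_apply, _root_.smul_apply, smul_eq_mul, htr, _root_.sum_apply,
      fderiv_fun_mul (hI _ _) (hfj _), fderiv_fderiv_apply hf.differentiableAt_fderiv]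
    ring
  rw [laplacian]
  simp only [hterm, ← Finset.mul_sum]
  rw [inv_mul_cancel_left₀ hs.ne']
  simp only [mul_sub, Finset.sum_sub_distrib, Finset.sum_add_distrib, fderiv_metricInv hG hinj]
  -- The derivative of the volume element cancels one of the two terms of the derivative of `gⁱʲ`.
  have e1 : ∑ i, ∑ j, fderiv ℝ f x (ei j) * ∑ l, metricInv G x l j *
      christoffel G x (ei i) (ei l) i = ∑ i, (∑ l, christoffel G x (ei i) (ei l) l) *
        ∑ j, metricInv G x i j * fderiv ℝ f x (ei j) := by
    rw [Finset.sum_comm]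
    simp only [Finset.mul_sum, Finset.sum_mul]
    conv_lhs =>
      enter [2, j]
      rw [Finset.sum_comm]
    rw [Finset.sum_comm]
    refine Finset.sum_congr rfl fun l _ => Finset.sum_congr rfl fun j _ =>
      Finset.sum_congr rfl fun i _ => ?_
    rw [christoffel_symm hG (ei i) (ei l)]
    ring
  have e2 : ∑ i, ∑ j, fderiv ℝ f x (ei j) * ∑ l, metricInv G x i l *
      christoffel G x (ei i) (ei l) j = ∑ i, ∑ j, metricInv G x i j *
        fderiv ℝ f x (christoffel G x (ei i) (ei j)) := by
    refine Finset.sum_congr rfl fun i _ => ?_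
    simp only [Finset.mul_sum]
    rw [Finset.sum_comm]
    refine Finset.sum_congr rfl fun l _ => ?_
    rw [clm_eq_sum_ei (fderiv ℝ f x), Finset.mul_sum]
    refine Finset.sum_congr rfl fun j _ => ?_
    rw [smul_eq_mul]; ring
  simp only [mul_neg, mul_add, Finset.sum_neg_distrib, Finset.sum_add_distrib, e1, e2]
  ring

/-! ### The parabolic operator applied to `unitOmega (dF)` -/

/-- The normal part of the Hessian: for an immersion `G`, `normalHess G x a b` is the normal part of
`D²G(a, b)`. -/
noncomputable def normalHess (G : E n → Amb n m) (x a : E n) : E n →L[ℝ] Amb n m :=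
  fderiv ℝ (fderiv ℝ G) x a - (fderiv ℝ G x).comp (christoffel G x a)

/-- The trace `∑ gⁱʲ ∂ᵢ∂ⱼG` of the Hessian with respect to the induced metric. -/
noncomputable def traceHess (G : E n → Amb n m) (x : E n) : Amb n m :=
  ∑ i, ∑ j, metricInv G x i j • fderiv ℝ (fderiv ℝ G) x (ei i) (ei j)

variable {G : E n → Amb n m} {x : E n}

lemma normalHess_apply (hinj : Function.Injective (fderiv ℝ G x)) (a b : E n) :
    normalHess G x a b = secondFF G x a b := by
  rw [secondFF, normalPart_eq hinj]
  rfl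

/-- The algebraic identity behind the evolution equation: by the invariance of `unitOmega`, the
tangential components of the Hessian cancel against the derivative of the inverse metric. -/
lemma fderiv_unitOmega_sub_hessian (hG : ContDiffAt ℝ 3 G x)
    (hinj : Function.Injective (fderiv ℝ G x)) {W : E n →L[ℝ] Amb n m}
    (hW : ∀ a, W a = ∑ i, ∑ j, fderiv ℝ (fun y => metricInv G y i j) x a •
      fderiv ℝ (fderiv ℝ G) x (ei i) (ei j)) :
    fderiv ℝ unitOmega (fderiv ℝ G x) W - ∑ i, ∑ j, metricInv G x i j *
      fderiv ℝ (fderiv ℝ unitOmega) (fderiv ℝ G x) (fderiv ℝ (fderiv ℝ G) x (ei i))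
        (fderiv ℝ (fderiv ℝ G) x (ei j)) =
    -∑ i, ∑ j, metricInv G x i j * fderiv ℝ (fderiv ℝ unitOmega) (fderiv ℝ G x)
      (normalHess G x (ei i)) (normalHess G x (ei j)) := by
  set L := fderiv ℝ G x with hLdef
  set B := fderiv ℝ (fderiv ℝ G) x with hB
  set Γ := christoffel G x with hΓ
  set D := fderiv ℝ unitOmega L with hD
  set D2 := fderiv ℝ (fderiv ℝ unitOmega) L with hD2
  have hBs : ∀ a b, B a b = B b a := (hG.of_le (by norm_num)).snd_fderiv_symm
  -- The derivative of the inverse metric, contracted with the Hessian, composes it with `Γ`.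
  have hW' : W = -(∑ i, ∑ j, metricInv G x i j • ((B (ei i)).comp (Γ (ei j)) +
      (B (ei j)).comp (Γ (ei i)))) := by
    ext1 a
    have e1 : ∑ i, ∑ j, (∑ l, metricInv G x l j * Γ a (ei l) i) • B (ei i) (ei j) =
        ∑ l, ∑ j, metricInv G x l j • B (ei j) (Γ (ei l) a) := by
      rw [Finset.sum_comm, Finset.sum_comm (s := Finset.univ) (t := Finset.univ)
        (f := fun l j => metricInv G x l j • B (ei j) (Γ (ei l) a))]
      refine Finset.sum_congr rfl fun j _ => ?_
      simp only [Finset.sum_smul]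
      rw [Finset.sum_comm]
      refine Finset.sum_congr rfl fun l _ => ?_
      rw [clm_eq_sum_ei (B (ei j)), Finset.smul_sum, hΓ, christoffel_symm hG (ei l) a]
      simp only [smul_smul, hBs (ei j)]
    have e2 : ∑ i, ∑ j, (∑ l, metricInv G x i l * Γ a (ei l) j) • B (ei i) (ei j) =
        ∑ i, ∑ l, metricInv G x i l • B (ei i) (Γ (ei l) a) := by
      refine Finset.sum_congr rfl fun i _ => ?_
      simp only [Finset.sum_smul]
      rw [Finset.sum_comm]
      refine Finset.sum_congr rfl fun l _ => ?_
      rw [clm_eq_sum_ei (B (ei i)), Finset.smul_sum, hΓ, christoffel_symm hG (ei l) a]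
      simp only [smul_smul]
    rw [hW]
    simp only [fderiv_metricInv hG hinj, neg_smul, add_smul, Finset.sum_neg_distrib,
      Finset.sum_add_distrib]
    rw [← hΓ, e1, e2]
    simp only [_root_.neg_apply, _root_.sum_apply, _root_.smul_apply, _root_.add_apply,
      ContinuousLinearMap.comp_apply, smul_add, Finset.sum_add_distrib]
    rw [add_comm]
  have hD0 : ∀ C : E n →L[ℝ] E n, D (L.comp C) = 0 := fderiv_unitOmega_self_comp hinj
  have hD2L : ∀ (C : E n →L[ℝ] E n) (W : E n →L[ℝ] Amb n m), D2 (L.comp C) W = -D (W.comp C) :=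
    fderiv_fderiv_unitOmega_self_comp hinj
  have hD2s : ∀ U W, D2 U W = D2 W U := (contDiffAt_unitOmega hinj).snd_fderiv_symm
  have hN : ∀ a, normalHess G x a = B a - L.comp (Γ a) := fun a => rfl
  have key : ∀ i j, D2 (normalHess G x (ei i)) (normalHess G x (ei j)) =
      D2 (B (ei i)) (B (ei j)) + (D ((B (ei i)).comp (Γ (ei j))) +
        D ((B (ei j)).comp (Γ (ei i)))) := by
    intro i j
    rw [hN, hN]
    simp only [map_sub, _root_.sub_apply]
    rw [hD2s (B (ei i)) (L.comp _), hD2L, hD2L, hD2L, ContinuousLinearMap.comp_assoc, hD0]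
    ring
  simp only [key, mul_add, Finset.sum_add_distrib, hW', map_neg, map_sum, map_smul, map_add,
    smul_eq_mul, smul_add]
  ring

section Flow

variable {F : ℝ → E n → Amb n m} {t : ℝ}

lemma eventually_hasFDerivAt_slice
    (hF : ContDiffAt ℝ 3 (fun p : ℝ × E n => F p.1 p.2) (t, x)) :
    ∀ᶠ p : ℝ × E n in 𝓝 (t, x), HasFDerivAt (F p.1)
      ((fderiv ℝ (fun p : ℝ × E n => F p.1 p.2) p).comp (ContinuousLinearMap.inr ℝ ℝ (E n))) p.2 ∧
      HasDerivAt (fun s => F s p.2) (fderiv ℝ (fun p : ℝ × E n => F p.1 p.2) p (1, 0)) p.1 := by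
  filter_upwards [(hF.of_le (by norm_num)).eventually_differentiableAt] with p hp
  constructor
  · exact HasFDerivAt.comp (g := fun p : ℝ × E n => F p.1 p.2) (f := fun y => (p.1, y)) p.2
      hp.hasFDerivAt (hasFDerivAt_prodMk_right p.1 p.2)
  · have h := HasFDerivAt.comp (g := fun p : ℝ × E n => F p.1 p.2) (f := fun s => (s, p.2)) p.1
      hp.hasFDerivAt (hasFDerivAt_prodMk_left p.1 p.2)
    exact h.hasDerivAt.congr_deriv (by simp)

lemma contDiffAt_slice {V : Type*} [NormedAddCommGroup V] [NormedSpace ℝ V] {v : ℝ → E n → V}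
    (hv : ContDiffAt ℝ 3 (fun p : ℝ × E n => v p.1 p.2) (t, x)) : ContDiffAt ℝ 3 (v t) x :=
  hv.comp (g := fun p : ℝ × E n => v p.1 p.2) (f := fun y => (t, y)) x
    (contDiffAt_const.prodMk contDiffAt_id)

/-- The differential of `F` in the space variables, as a function of time and space. -/
lemma spaceDeriv_eventuallyEq (hF : ContDiffAt ℝ 3 (fun p : ℝ × E n => F p.1 p.2) (t, x)) :
    (fun p : ℝ × E n => fderiv ℝ (F p.1) p.2) =ᶠ[𝓝 (t, x)] fun p =>
      (fderiv ℝ (fun p : ℝ × E n => F p.1 p.2) p).comp (ContinuousLinearMap.inr ℝ ℝ (E n)) :=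
  (eventually_hasFDerivAt_slice hF).mono fun _ h => h.1.fderiv

lemma contDiffAt_spaceDeriv (hF : ContDiffAt ℝ 3 (fun p : ℝ × E n => F p.1 p.2) (t, x)) :
    ContDiffAt ℝ 2 (fun p : ℝ × E n => fderiv ℝ (F p.1) p.2) (t, x) :=
  ((hF.fderiv_right (m := 2) (by norm_num)).clm_comp contDiffAt_const).congr_of_eventuallyEq
    (spaceDeriv_eventuallyEq hF)

lemma tendsto_prodMk_right (t : ℝ) (x : E n) :
    Filter.Tendsto (fun y => (t, y)) (𝓝 x) (𝓝 (t, x)) :=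
  (Continuous.prodMk_right t).tendsto x

lemma tendsto_prodMk_left (t : ℝ) (x : E n) :
    Filter.Tendsto (fun s => (s, x)) (𝓝 t) (𝓝 (t, x)) :=
  (Continuous.prodMk_left x).tendsto t

/-- The velocity is differentiable in space, and time and space derivatives commute. -/
lemma hasFDerivAt_velocity (hF : ContDiffAt ℝ 3 (fun p : ℝ × E n => F p.1 p.2) (t, x)) :
    HasFDerivAt (fun y => deriv (fun s => F s y) t)
      (fderiv ℝ (fun p : ℝ × E n => fderiv ℝ (F p.1) p.2) (t, x) (1, 0)) x := by
  set FF : ℝ × E n → Amb n m := fun p => F p.1 p.2 with hFF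
  have h2 : ContDiffAt ℝ 2 FF (t, x) := hF.of_le (by norm_num)
  have hV : (fun y => deriv (fun s => F s y) t) =ᶠ[𝓝 x] fun y => fderiv ℝ FF (t, y) (1, 0) := by
    filter_upwards [(tendsto_prodMk_right t x).eventually (eventually_hasFDerivAt_slice hF)]
      with y hy using hy.2.deriv
  have hd : HasFDerivAt (fun y => fderiv ℝ FF (t, y))
      ((fderiv ℝ (fderiv ℝ FF) (t, x)).comp (ContinuousLinearMap.inr ℝ ℝ (E n))) x :=
    HasFDerivAt.comp (g := fderiv ℝ FF) x h2.differentiableAt_fderiv.hasFDerivAt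
      (hasFDerivAt_prodMk_right t x)
  have hd' := (hd.clm_apply (hasFDerivAt_const ((1 : ℝ), (0 : E n)) x)).congr_of_eventuallyEq hV
  refine hd'.congr_fderiv ?_
  rw [(spaceDeriv_eventuallyEq hF).fderiv_eq,
    (h2.differentiableAt_fderiv.hasFDerivAt.clm_comp (hasFDerivAt_const _ _)).fderiv]
  ext1 a
  simp [h2.snd_fderiv_symm (0, a)]

lemma fderiv_fderiv_fderiv_symm (hG : ContDiffAt ℝ 3 G x) (a b c : E n) :
    fderiv ℝ (fderiv ℝ (fderiv ℝ G)) x a b c = fderiv ℝ (fderiv ℝ (fderiv ℝ G)) x b c a := by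
  have hL := contDiffAt_fderiv hG
  have hd := hL.differentiableAt_fderiv
  have h : ∀ b c : E n, HasFDerivAt (fun y => fderiv ℝ (fderiv ℝ G) y b c)
      (((fderiv ℝ (fderiv ℝ (fderiv ℝ G)) x).flip b).flip c) x := by
    intro b c
    have h1 := (hd.hasFDerivAt.clm_apply (hasFDerivAt_const b x)).clm_apply
      (hasFDerivAt_const c x)
    refine h1.congr_fderiv ?_
    ext1 v
    simp
  have hs : (fun y => fderiv ℝ (fderiv ℝ G) y a c) =ᶠ[𝓝 x]
      fun y => fderiv ℝ (fderiv ℝ G) y c a := by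
    filter_upwards [(hG.of_le (m := 2) (by norm_num)).eventually (by simp)] with y hy
    exact hy.snd_fderiv_symm a c
  have h2 := (h a c).unique ((h c a).congr_of_eventuallyEq hs)
  rw [hL.snd_fderiv_symm a b]
  exact congrArg (fun T => T b) h2

lemma hasFDerivAt_traceHess (hG : ContDiffAt ℝ 3 G x)
    (hinj : Function.Injective (fderiv ℝ G x)) :
    HasFDerivAt (traceHess G)
      ((∑ i, ∑ j, (fderiv ℝ (fun y => metricInv G y i j) x).smulRight
        (fderiv ℝ (fderiv ℝ G) x (ei i) (ei j))) +
      ∑ i, ∑ j, metricInv G x i j • fderiv ℝ (fderiv ℝ (fderiv ℝ G)) x (ei i) (ei j)) x := by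
  have hd := (contDiffAt_fderiv hG).differentiableAt_fderiv
  simp only [← Finset.sum_add_distrib]
  refine HasFDerivAt.fun_sum fun i _ => HasFDerivAt.fun_sum fun j _ => ?_
  have h1 := (hd.hasFDerivAt.clm_apply (hasFDerivAt_const (ei i) x)).clm_apply
    (hasFDerivAt_const (ei j) x)
  have h2 := ((contDiffAt_metricInv hG hinj i j).differentiableAt two_ne_zero).hasFDerivAt
  refine (h2.fun_smul h1).congr_fderiv ?_
  ext1 v
  simp [fderiv_fderiv_fderiv_symm hG v, add_comm]

/-- The tangential correction in `normalTimeDeriv`, in terms of the tangential part of `v`. -/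
lemma sum_metricInv_inner (v : Amb n m) (T : E n →L[ℝ] ℝ) :
    ∑ i, ∑ j, metricInv G x i j * inner ℝ v (tang G x i) * T (ei j) =
      T (tangCoord (fderiv ℝ G x) v) := by
  rw [tangCoord_apply, Finset.sum_comm]
  simp only [map_sum, map_smul, smul_eq_mul]
  refine Finset.sum_congr rfl fun j _ => Finset.sum_congr rfl fun i _ => ?_
  rw [metricInv_symm, real_inner_comm]
  rfl

lemma differentiableAt_tangCoord (hG : ContDiffAt ℝ 3 G x)
    (hinj : Function.Injective (fderiv ℝ G x)) {Z : E n → Amb n m}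
    (hZ : DifferentiableAt ℝ Z x) :
    DifferentiableAt ℝ (fun y => tangCoord (fderiv ℝ G y) (Z y)) x := by
  simp only [tangCoord_apply]
  refine DifferentiableAt.fun_sum fun k _ => DifferentiableAt.fun_sum fun l _ => ?_
  refine DifferentiableAt.smul_const ?_ _
  refine ((contDiffAt_metricInv hG hinj k l).differentiableAt two_ne_zero).mul ?_
  exact (((contDiffAt_fderiv hG).differentiableAt two_ne_zero).clm_apply
    (differentiableAt_const _)).inner ℝ hZ

/-- **Evolution equation.** If the difference of the velocity and of the trace of the Hessian is
tangential, the parabolic operator applied to `unitOmega (dF)` only sees the second fundamental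
form, through the Hessian of `unitOmega`. -/
theorem normalTimeDeriv_sub_laplacian_eq {c : ℝ} {f : ℝ → E n → ℝ}
    (hF : ContDiffAt ℝ 3 (fun p : ℝ × E n => F p.1 p.2) (t, x))
    (hinj : Function.Injective (fderiv ℝ (F t) x))
    (hflow : ∀ᶠ y in 𝓝 x,
      deriv (fun s => F s y) t - traceHess (F t) y ∈ tangentSpace (F t) y)
    (hf : (fun p : ℝ × E n => f p.1 p.2) =ᶠ[𝓝 (t, x)]
      fun p => c * unitOmega (fderiv ℝ (F p.1) p.2)) :
    ContDiffAt ℝ 2 (fun p : ℝ × E n => f p.1 p.2) (t, x) ∧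
    normalTimeDeriv F f t x - laplacian (F t) (f t) x =
      -(c * ∑ i, ∑ j, metricInv (F t) x i j *
        fderiv ℝ (fderiv ℝ unitOmega) (fderiv ℝ (F t) x)
          (normalHess (F t) x (ei i)) (normalHess (F t) x (ei j))) := by
  have hΨ := contDiffAt_spaceDeriv hF
  have hφ := contDiffAt_unitOmega hinj
  have hφΨ : ContDiffAt ℝ 2 (fun p : ℝ × E n => c * unitOmega (fderiv ℝ (F p.1) p.2)) (t, x) :=
    contDiffAt_const.mul (hφ.comp (g := unitOmega) (t, x) hΨ)
  have hfC : ContDiffAt ℝ 2 (fun p : ℝ × E n => f p.1 p.2) (t, x) := hφΨ.congr_of_eventuallyEq hf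
  refine ⟨hfC, ?_⟩
  have hG := contDiffAt_slice hF
  have hL := contDiffAt_fderiv hG
  -- The space derivatives of `f t`.
  have hft : f t =ᶠ[𝓝 x] fun y => c * unitOmega (fderiv ℝ (F t) y) :=
    (tendsto_prodMk_right t x).eventually hf
  have hψ : ContDiffAt ℝ 2 (fun y => unitOmega (fderiv ℝ (F t) y)) x :=
    hφ.comp (g := unitOmega) x hL
  have hftC : ContDiffAt ℝ 2 (f t) x := (contDiffAt_const.mul hψ).congr_of_eventuallyEq hft
  have hf' : ∀ a, fderiv ℝ (f t) x a =
      c * fderiv ℝ unitOmega (fderiv ℝ (F t) x) (fderiv ℝ (fderiv ℝ (F t)) x a) := by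
    intro a
    rw [hft.fderiv_eq, fderiv_const_mul (hψ.differentiableAt two_ne_zero),
      fderiv_fun_comp (g := unitOmega) x (hφ.differentiableAt two_ne_zero)
        (hL.differentiableAt two_ne_zero)]
    simp
  have hf'' : ∀ a b, fderiv ℝ (fderiv ℝ (f t)) x a b = c *
      (fderiv ℝ (fderiv ℝ unitOmega) (fderiv ℝ (F t) x) (fderiv ℝ (fderiv ℝ (F t)) x a)
          (fderiv ℝ (fderiv ℝ (F t)) x b) +
        fderiv ℝ unitOmega (fderiv ℝ (F t) x) (fderiv ℝ (fderiv ℝ (fderiv ℝ (F t))) x a b)) := by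
    intro a b
    have h1 : fderiv ℝ (f t) =ᶠ[𝓝 x] fun y =>
        c • fderiv ℝ (fun y => unitOmega (fderiv ℝ (F t) y)) y := by
      filter_upwards [hft.eventuallyEq_nhds, hψ.eventually_differentiableAt] with y h1 h2
      rw [h1.fderiv_eq, fderiv_const_mul h2]
    rw [h1.fderiv_eq, fderiv_fun_const_smul hψ.differentiableAt_fderiv, ← fderiv_fderiv_comp hφ hL]
    simp
  -- The time derivative of `f`.
  set Ψ' : E n →L[ℝ] Amb n m :=
    fderiv ℝ (fun p : ℝ × E n => fderiv ℝ (F p.1) p.2) (t, x) (1, 0) with hΨ'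
  have htime : deriv (fun s => f s x) t =
      c * fderiv ℝ unitOmega (fderiv ℝ (F t) x) Ψ' := by
    have h1 : (fun s => f s x) =ᶠ[𝓝 t] fun s => c * unitOmega (fderiv ℝ (F s) x) :=
      (tendsto_prodMk_left t x).eventually hf
    have h2 : HasDerivAt (fun s => fderiv ℝ (F s) x) Ψ' t := by
      have h := HasFDerivAt.comp (g := fun p : ℝ × E n => fderiv ℝ (F p.1) p.2)
        (f := fun s => (s, x)) t (hΨ.differentiableAt two_ne_zero).hasFDerivAt
        (hasFDerivAt_prodMk_left t x)
      exact h.hasDerivAt.congr_deriv (by simp [hΨ'])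
    have h3 := HasFDerivAt.comp_hasDerivAt (l := unitOmega) (f := fun s => fderiv ℝ (F s) x) t
      (hφ.differentiableAt two_ne_zero).hasFDerivAt h2
    rw [h1.deriv_eq]
    exact (h3.const_mul c).deriv
  -- Differentiating the flow equation in space computes the time derivative of `dF`.
  set Z : E n → Amb n m := fun y => deriv (fun s => F s y) t - traceHess (F t) y with hZ
  set ξ : E n → E n := fun y => tangCoord (fderiv ℝ (F t) y) (Z y) with hξ
  have hZd := (hasFDerivAt_velocity hF).fun_sub (hasFDerivAt_traceHess hG hinj)
  have hξd : DifferentiableAt ℝ ξ x := differentiableAt_tangCoord hG hinj hZd.differentiableAt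
  have hZξ : Z =ᶠ[𝓝 x] fun y => fderiv ℝ (F t) y (ξ y) := by
    filter_upwards [hflow, hL.continuousAt.eventually (eventually_injective hinj)] with y h1 h2
    obtain ⟨v, hv⟩ := h1
    change fderiv ℝ (F t) y v = Z y at hv
    simp only [hξ]
    rw [← hv, tangCoord_comp h2]
  have hΨeq := hZd.unique (((hL.differentiableAt two_ne_zero).hasFDerivAt.clm_apply
    hξd.hasFDerivAt).congr_of_eventuallyEq hZξ)
  rw [sub_eq_iff_eq_add] at hΨeq
  have hflip : (fderiv ℝ (fderiv ℝ (F t)) x).flip (ξ x) = fderiv ℝ (fderiv ℝ (F t)) x (ξ x) := by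
    ext1 v
    exact (hG.of_le (by norm_num)).snd_fderiv_symm v (ξ x)
  have hξx : ξ x = tangCoord (fderiv ℝ (F t) x) (deriv (fun s => F s x) t) -
      ∑ i, ∑ j, metricInv (F t) x i j • christoffel (F t) x (ei i) (ei j) := by
    simp only [hξ, hZ, traceHess, map_sub, map_sum, map_smul]
    rfl
  -- The third derivatives of `F` now cancel, and only terms in its Hessian remain.
  have hW := fderiv_unitOmega_sub_hessian hG hinj
    (W := ∑ i, ∑ j, (fderiv ℝ (fun y => metricInv (F t) y i j) x).smulRight
        (fderiv ℝ (fderiv ℝ (F t)) x (ei i) (ei j))) (by simp [_root_.sum_apply])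
  rw [normalTimeDeriv, laplacian_eq hG hinj hftC, sum_metricInv_inner, htime, hΨ', hΨeq, hflip, hξx]
  simp only [hf', hf'', map_add, map_sub, fderiv_unitOmega_self_comp hinj]
  rw [sub_eq_iff_eq_add] at hW
  rw [hW]
  simp only [map_sum, map_smul, smul_eq_mul, mul_sub, mul_add, Finset.sum_sub_distrib,
    Finset.sum_add_distrib, Finset.mul_sum, mul_neg, mul_left_comm c]
  ring

end Flow

end GraphMCF

/-! ### Algebraic inequalities -/

lemma one_add_sum_le_prod {ι : Type*} (s : Finset ι) {a : ι → ℝ} (ha : ∀ i, 0 ≤ a i) :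
    1 + ∑ i ∈ s, a i ≤ ∏ i ∈ s, (1 + a i) := by
  classical
  induction s using Finset.induction_on with
  | empty => simp
  | insert i s hi ih =>
    rw [Finset.sum_insert hi, Finset.prod_insert hi]
    have := Finset.sum_nonneg (s := s) fun i _ => ha i
    nlinarith [ha i, mul_le_mul_of_nonneg_left ih (add_nonneg zero_le_one (ha i)),
      mul_nonneg (ha i) this]

/-- For the eigenvalues `λᵢ ≥ 0` this is `1 + ∑ λᵢ ≤ ∏ (1 + λᵢ)`. -/
lemma Matrix.PosSemidef.one_add_trace_le_det {ι : Type*} [Fintype ι] [DecidableEq ι]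
    {S : Matrix ι ι ℝ} (hS : S.PosSemidef) : 1 + S.trace ≤ (1 + S).det := by
  have h1 : (1 + S).det = ∏ i, (1 + hS.1.eigenvalues i) := by
    have h := congrArg (Polynomial.eval (-1)) hS.1.charpoly_eq
    rw [Matrix.eval_charpoly, Polynomial.eval_prod] at h
    have e : Matrix.scalar ι (-1 : ℝ) - S = -(1 + S) := by
      rw [neg_add, map_neg, map_one, sub_eq_add_neg]
    rw [e, Matrix.det_neg] at h
    have e2 : ∏ i, Polynomial.eval (-1) (Polynomial.X - Polynomial.C (hS.1.eigenvalues i : ℝ)) =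
        (-1) ^ Fintype.card ι * ∏ i, (1 + hS.1.eigenvalues i) := by
      rw [← Finset.card_univ, ← Finset.prod_const, ← Finset.prod_mul_distrib]
      refine Finset.prod_congr rfl fun i _ => ?_
      simp; ring
    exact mul_left_cancel₀ (by simp) (h.trans e2)
  rw [h1, hS.1.trace_eq_sum_eigenvalues]
  exact one_add_sum_le_prod _ hS.eigenvalues_nonneg

section Minors

variable {ι κ : Type*} [Fintype ι] [Fintype κ]

/-- A bound for the sum of the squares of the `2 × 2` minors, where every minor of rows `i ≠ j` and
columns `α ≠ β` is counted four times. -/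
lemma sum_minor_sq_le (H : ι → κ → ℝ) :
    ∑ i, ∑ j, ∑ α, ∑ β, (H i α * H j β - H j α * H i β) ^ 2 ≤ 2 * (∑ i, ∑ α, H i α ^ 2) ^ 2 := by
  have h : ∀ i j, ∑ α, ∑ β, (H i α * H j β - H j α * H i β) ^ 2 =
      2 * ((∑ α, H i α ^ 2) * ∑ β, H j β ^ 2) - 2 * (∑ α, H i α * H j α) ^ 2 := by
    intro i j
    have e : ∀ α β, (H i α * H j β - H j α * H i β) ^ 2 =
        H i α ^ 2 * H j β ^ 2 + H j α ^ 2 * H i β ^ 2 -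
          2 * ((H i α * H j α) * (H i β * H j β)) := fun α β => by ring
    simp only [e, Finset.sum_sub_distrib, Finset.sum_add_distrib, ← Finset.mul_sum,
      ← Finset.sum_mul]
    ring
  simp only [h, Finset.sum_sub_distrib, ← Finset.mul_sum, ← Finset.sum_mul]
  have : 0 ≤ ∑ i, ∑ j, (∑ α, H i α * H j α) ^ 2 :=
    Finset.sum_nonneg fun i _ => Finset.sum_nonneg fun j _ => sq_nonneg _
  nlinarith

/-- Twice the second elementary symmetric function of `K = H Mᵀ` is bounded by `|H|² |M|²`, by the
Cauchy-Schwarz inequality for `2 × 2` minors. -/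
lemma sum_minor_mul_le (H M : ι → κ → ℝ) {K : ι → ι → ℝ} (hK : ∀ i j, K i j = ∑ α, H i α * M j α) :
    ∑ i, ∑ j, (K i i * K j j - K i j * K j i) ≤
      (∑ i, ∑ α, H i α ^ 2) * ∑ i, ∑ α, M i α ^ 2 := by
  set S := ∑ i, ∑ j, (K i i * K j j - K i j * K j i) with hS
  have e1 : S = ∑ i, ∑ j, ∑ α, ∑ β, H i α * H j β * (M i α * M j β - M j α * M i β) := by
    refine Finset.sum_congr rfl fun i _ => Finset.sum_congr rfl fun j _ => ?_
    simp only [hK, Finset.sum_mul_sum, ← Finset.sum_sub_distrib]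
    exact Finset.sum_congr rfl fun α _ => Finset.sum_congr rfl fun β _ => by ring
  -- Antisymmetrizing in `i` and `j` turns both factors into minors; without it, the constant of
  -- the estimate would be worse by a factor `√2`.
  have e2 : S = -∑ i, ∑ j, ∑ α, ∑ β, H j α * H i β * (M i α * M j β - M j α * M i β) := by
    rw [e1, Finset.sum_comm]
    simp only [← Finset.sum_neg_distrib]
    refine Finset.sum_congr rfl fun i _ => Finset.sum_congr rfl fun j _ =>
      Finset.sum_congr rfl fun α _ => Finset.sum_congr rfl fun β _ => by ring
  have e3 : 2 * S = ∑ i, ∑ j, ∑ α, ∑ β, (H i α * H j β - H j α * H i β) *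
      (M i α * M j β - M j α * M i β) := by
    simp only [sub_mul (_ * _) (_ * _) (_ - _), Finset.sum_sub_distrib]
    rw [← e1]; linarith
  have cs := Finset.sum_mul_sq_le_sq_mul_sq (Finset.univ : Finset (ι × ι × κ × κ))
    (fun p => H p.1 p.2.2.1 * H p.2.1 p.2.2.2 - H p.2.1 p.2.2.1 * H p.1 p.2.2.2)
    (fun p => M p.1 p.2.2.1 * M p.2.1 p.2.2.2 - M p.2.1 p.2.2.1 * M p.1 p.2.2.2)
  simp only [Fintype.sum_prod_type] at cs
  rw [← e3] at cs
  have hH := sum_minor_sq_le H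
  have hM := sum_minor_sq_le M
  have hH0 : 0 ≤ ∑ i, ∑ α, H i α ^ 2 := by positivity
  have hM0 : 0 ≤ ∑ i, ∑ α, M i α ^ 2 := by positivity
  have hprod := mul_le_mul hH hM (by positivity) (by positivity)
  refine le_of_sq_le_sq ?_ (mul_nonneg hH0 hM0)
  nlinarith

end Minors

section Alternating

variable {V ι : Type*} [AddCommGroup V] [Module ℝ V] [Fintype ι] [DecidableEq ι]
  (f : V [⋀^ι]→ₗ[ℝ] ℝ)

lemma AlternatingMap.map_update_lincomb (v : ι → V) (i : ι) (c : ι → ℝ) :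
    f (Function.update v i (∑ a, c a • v a)) = c i * f v := by
  rw [f.map_update_sum]
  simp only [f.map_update_smul, smul_eq_mul]
  rw [Finset.sum_eq_single i]
  · simp
  · intro a _ ha
    rw [f.map_update_self v ha.symm, mul_zero]
  · simp

/-- Replacing two arguments of an alternating form by combinations of all arguments multiplies it by
a `2 × 2` minor of the coefficients. -/
lemma AlternatingMap.map_update_update_lincomb (v : ι → V) {i j : ι} (hij : i ≠ j) (c d : ι → ℝ) :
    f (Function.update (Function.update v i (∑ a, c a • v a)) j (∑ a, d a • v a)) =
      (c i * d j - c j * d i) * f v := by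
  set X := ∑ a, c a • v a with hX
  set u := Function.update v i X with hu
  have e : ∑ a, d a • v a = ∑ a, (Function.update d i 0) a • u a + d i • v i := by
    rw [← Finset.sum_erase_add _ _ (Finset.mem_univ i),
      ← Finset.sum_erase_add Finset.univ (fun a => (Function.update d i 0) a • u a)
      (Finset.mem_univ i)]
    simp only [Function.update_self, zero_smul, add_zero]
    congr 1
    refine Finset.sum_congr rfl fun a ha => ?_
    rw [hu, Function.update_of_ne (Finset.ne_of_mem_erase ha),
      Function.update_of_ne (Finset.ne_of_mem_erase ha)]
  have e2 : f (Function.update u j (v i)) = -(c j * f v) := by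
    have h : Function.update u j (v i) = Function.update v j X ∘ Equiv.swap i j := by
      funext a
      by_cases h1 : a = j
      · subst h1; simp [hij]
      · by_cases h2 : a = i
        · subst h2; simp [hu, h1]
        · simp [hu, h1, h2, Equiv.swap_apply_of_ne_of_ne h2 h1]
    rw [h, f.map_swap _ hij, hX, f.map_update_lincomb]
  rw [e, f.map_update_add, f.map_update_lincomb, f.map_update_smul, e2, hu, hX,
    f.map_update_lincomb, Function.update_of_ne hij.symm, smul_eq_mul]
  ring

end Alternating

namespace GraphMCF

variable {n m : ℕ}

/-! ### Adapted orthonormal frames -/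

lemma orthonormal_sumElim {τ : Fin n → Amb n m} {ν : Fin m → Amb n m} (hτ : Orthonormal ℝ τ)
    (hν : Orthonormal ℝ ν) (h : ∀ i α, inner ℝ (τ i) (ν α) = 0) :
    Orthonormal ℝ (Sum.elim τ ν) := by
  refine ⟨by rintro (i | α) <;> simp [hτ.1, hν.1], ?_⟩
  rintro (i | α) (j | β) hne
  · exact hτ.2 (by simpa using hne)
  · exact h i β
  · exact (real_inner_comm _ _).trans (h j α)
  · exact hν.2 (by simpa using hne)

/-- An orthonormal basis of `ℝⁿ⁺ᵐ` adapted to a decomposition into a tangent and a normal space. -/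
noncomputable def frameBasis {τ : Fin n → Amb n m} {ν : Fin m → Amb n m} (hτ : Orthonormal ℝ τ)
    (hν : Orthonormal ℝ ν) (h : ∀ i α, inner ℝ (τ i) (ν α) = 0) :
    OrthonormalBasis (Fin n ⊕ Fin m) ℝ (Amb n m) :=
  OrthonormalBasis.mk (orthonormal_sumElim hτ hν h) (by
    rw [(orthonormal_sumElim hτ hν h).linearIndependent.span_eq_top_of_card_eq_finrank' (by simp)])

lemma frameBasis_inl {τ : Fin n → Amb n m} {ν : Fin m → Amb n m} (hτ : Orthonormal ℝ τ)
    (hν : Orthonormal ℝ ν) (h : ∀ i α, inner ℝ (τ i) (ν α) = 0) (i : Fin n) :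
    frameBasis hτ hν h (Sum.inl i) = τ i :=
  congrFun (OrthonormalBasis.coe_mk (orthonormal_sumElim hτ hν h) _) _

lemma frameBasis_inr {τ : Fin n → Amb n m} {ν : Fin m → Amb n m} (hτ : Orthonormal ℝ τ)
    (hν : Orthonormal ℝ ν) (h : ∀ i α, inner ℝ (τ i) (ν α) = 0) (α : Fin m) :
    frameBasis hτ hν h (Sum.inr α) = ν α :=
  congrFun (OrthonormalBasis.coe_mk (orthonormal_sumElim hτ hν h) _) _

lemma eq_sum_of_normal {τ : Fin n → Amb n m} {ν : Fin m → Amb n m} (hτ : Orthonormal ℝ τ)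
    (hν : Orthonormal ℝ ν) (h : ∀ i α, inner ℝ (τ i) (ν α) = 0) {w : Amb n m}
    (hw : ∀ i, inner ℝ (τ i) w = 0) : w = ∑ α, inner ℝ w (ν α) • ν α := by
  conv_lhs => rw [← (frameBasis hτ hν h).sum_repr' w]
  simp only [Fintype.sum_sum_type, frameBasis_inl, frameBasis_inr, hw, zero_smul,
    Finset.sum_const_zero, zero_add]
  exact Finset.sum_congr rfl fun α _ => by rw [real_inner_comm]

lemma norm_sq_eq_sum_of_normal {τ : Fin n → Amb n m} {ν : Fin m → Amb n m}
    (hτ : Orthonormal ℝ τ) (hν : Orthonormal ℝ ν) (h : ∀ i α, inner ℝ (τ i) (ν α) = 0)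
    {w : Amb n m} (hw : ∀ i, inner ℝ (τ i) w = 0) : ‖w‖ ^ 2 = ∑ α, inner ℝ w (ν α) ^ 2 := by
  rw [← (frameBasis hτ hν h).sum_sq_norm_inner_left w]
  simp [Fintype.sum_sum_type, frameBasis_inl, frameBasis_inr, real_inner_comm (τ _) w, hw]

/-- The second order term of the evolution equation is bounded by `1 - ω(τ)²`: the projections of
normal vectors are expressed through those of `τ`, with a coefficient matrix `N` for which
`det (1 + Nᵀ N) = ω(τ)⁻²`. -/
lemma omega_mul_sum_le {τ : Fin n → Amb n m} {ν : Fin m → Amb n m} (hτ : Orthonormal ℝ τ)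
    (hν : Orthonormal ℝ ν) (h : ∀ i α, inner ℝ (τ i) (ν α) = 0) (hω : omega n m τ ≠ 0)
    {w : Fin n → Amb n m} (hw : ∀ i j, inner ℝ (τ i) (w j) = 0) :
    omega n m τ * ∑ i, ∑ j ∈ Finset.univ.erase i,
      omega n m (Function.update (Function.update τ i (w i)) j (w j)) ≤
    (1 - omega n m τ ^ 2) * ∑ i, ‖w i‖ ^ 2 := by
  set p := omega n m τ with hp
  let π : Amb n m →ₗ[ℝ] (Fin n → ℝ) :=
    { toFun := fun p i => p (Sum.inl i), map_add' := fun _ _ => rfl, map_smul' := fun _ _ => rfl }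
  set P : Matrix (Fin n) (Fin n) ℝ := Matrix.of fun i => π (τ i) with hP
  set Q : Matrix (Fin m) (Fin n) ℝ := Matrix.of fun α => π (ν α) with hQ
  have hPdet : P.det = p := rfl
  have hPu : IsUnit P.det := isUnit_iff_ne_zero.2 hω
  set N : Matrix (Fin m) (Fin n) ℝ := Q * P⁻¹ with hN
  have hNP : N * P = Q := Matrix.nonsing_inv_mul_cancel_right _ _ hPu
  -- The columns of the orthogonal matrix of the frame `τ, ν` are orthonormal.
  have hPQ : Pᵀ * P + Qᵀ * Q = 1 := by
    ext a b
    have e := (frameBasis hτ hν h).sum_inner_mul_inner (EuclideanSpace.single (Sum.inl a) 1)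
      (EuclideanSpace.single (Sum.inl b) 1)
    simp only [Fintype.sum_sum_type, frameBasis_inl, frameBasis_inr] at e
    have hl : ∀ (c : Fin n ⊕ Fin m) (v : Amb n m),
        inner ℝ (EuclideanSpace.single c (1 : ℝ)) v = v c := fun c v => by
      rw [EuclideanSpace.inner_single_left]; simp
    have hr : ∀ (c : Fin n ⊕ Fin m) (v : Amb n m),
        inner ℝ v (EuclideanSpace.single c (1 : ℝ)) = v c := fun c v => by
      rw [real_inner_comm, hl]
    rw [hl] at e
    simp only [hl, hr] at e
    rw [Matrix.add_apply, Matrix.mul_apply, Matrix.mul_apply]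
    refine e.trans ?_
    simp [Matrix.one_apply]
  have hdet : p ^ 2 * (1 + Nᵀ * N).det = 1 := by
    have e : Pᵀ * (1 + Nᵀ * N) * P = Pᵀ * P + (N * P)ᵀ * (N * P) := by
      rw [Matrix.transpose_mul N P, Matrix.mul_add, Matrix.add_mul, Matrix.mul_one]
      simp only [Matrix.mul_assoc]
    rw [hNP, hPQ] at e
    have e2 := congrArg Matrix.det e
    rw [Matrix.det_mul, Matrix.det_mul, Matrix.det_transpose, Matrix.det_one, hPdet] at e2
    linarith
  have htr : 1 + ∑ a, ∑ α, N α a ^ 2 ≤ (1 + Nᵀ * N).det := by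
    have e := (Matrix.posSemidef_conjTranspose_mul_self N).one_add_trace_le_det
    rw [Matrix.conjTranspose_eq_transpose_of_trivial] at e
    simpa [Matrix.trace, Matrix.mul_apply, sq] using e
  set H : Fin n → Fin m → ℝ := fun i α => inner ℝ (w i) (ν α) with hH
  set K : Fin n → Fin n → ℝ := fun i a => ∑ α, H i α * N α a with hK
  have hπν : ∀ α, π (ν α) = ∑ a, N α a • π (τ a) := by
    intro α
    ext b
    have e := congrFun (congrFun hNP α) b
    rw [Matrix.mul_apply] at e
    simpa [hQ, hP] using e.symm
  have hπw : ∀ i, π (w i) = ∑ a, K i a • π (τ a) := by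
    intro i
    rw [eq_sum_of_normal hτ hν h (hw · i), map_sum]
    simp only [map_smul, hπν, Finset.smul_sum, smul_smul, hK, Finset.sum_smul]
    rw [Finset.sum_comm]
  have hterm : ∀ i j, i ≠ j → omega n m (Function.update (Function.update τ i (w i)) j (w j)) =
      (K i i * K j j - K i j * K j i) * p := by
    intro i j hij
    have e := (Matrix.detRowAlternating (n := Fin n) (R := ℝ)).map_update_update_lincomb
      (fun a => π (τ a)) hij (K i) (K j)
    rw [← hπw, ← hπw] at e
    refine Eq.trans ?_ e
    change Matrix.detRowAlternating (π ∘ _) = _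
    rw [Function.comp_update, Function.comp_update]
    rfl
  have hsum : ∑ i, ∑ j ∈ Finset.univ.erase i,
      omega n m (Function.update (Function.update τ i (w i)) j (w j)) =
      (∑ i, ∑ j, (K i i * K j j - K i j * K j i)) * p := by
    rw [Finset.sum_mul]
    refine Finset.sum_congr rfl fun i _ => ?_
    rw [← Finset.add_sum_erase Finset.univ _ (Finset.mem_univ i), sub_self, zero_add,
      Finset.sum_mul]
    exact Finset.sum_congr rfl fun j hj => hterm i j (Finset.ne_of_mem_erase hj).symm
  have hw2 : ∑ i, ‖w i‖ ^ 2 = ∑ i, ∑ α, H i α ^ 2 :=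
    Finset.sum_congr rfl fun i _ => norm_sq_eq_sum_of_normal hτ hν h (hw · i)
  have hmain := sum_minor_mul_le H (fun a α => N α a) (K := K) fun i j => rfl
  rw [hsum, hw2]
  have hH0 : 0 ≤ ∑ i, ∑ α, H i α ^ 2 := by positivity
  have hp2 : p ^ 2 * ∑ a, ∑ α, N α a ^ 2 ≤ 1 - p ^ 2 := by
    nlinarith [mul_le_mul_of_nonneg_left htr (sq_nonneg p)]
  nlinarith [mul_le_mul_of_nonneg_left hmain (sq_nonneg p), mul_le_mul_of_nonneg_right hp2 hH0]

/-! ### The evolution equation in an orthonormal frame -/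

/-- The normal part of the Hessian as a bilinear map. -/
noncomputable def normalHessₗ (G : E n → Amb n m) (x : E n) : E n →ₗ[ℝ] E n →L[ℝ] Amb n m where
  toFun := normalHess G x
  map_add' a b := by
    ext1 v
    simp only [normalHess, christoffel, map_add, _root_.sub_apply, _root_.add_apply,
      ContinuousLinearMap.comp_apply]
    abel
  map_smul' r a := by
    ext1 v
    simp only [normalHess, christoffel, map_smul, _root_.sub_apply, _root_.smul_apply,
      ContinuousLinearMap.comp_apply, smul_sub, RingHom.id_apply]

lemma normalHessₗ_apply (G : E n → Amb n m) (x a : E n) : normalHessₗ G x a = normalHess G x a :=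
  rfl

lemma inner_normalHess {G : E n → Amb n m} {x : E n} (hinj : Function.Injective (fderiv ℝ G x))
    (a u v : E n) : inner ℝ (fderiv ℝ G x u) (normalHess G x a v) = 0 :=
  inner_sub_tangCoord hinj _ u

lemma normSqA_eq {G : E n → Amb n m} {x : E n} (hinj : Function.Injective (fderiv ℝ G x))
    {b : Fin n → E n} (hb : Orthonormal ℝ fun i => fderiv ℝ G x (b i)) :
    normSqA G x = ∑ k, ∑ i, ‖normalHess G x (b k) (b i)‖ ^ 2 := by
  have h1 : ∀ a c, ∑ j, ∑ l, metricInv G x j l *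
      inner ℝ (normalHess G x a (ei j)) (normalHess G x c (ei l)) =
      ∑ q, inner ℝ (normalHess G x a (b q)) (normalHess G x c (b q)) := fun a c =>
    sum_gramOf_inv_eq hb (LinearMap.mk₂ ℝ
      (fun j l => inner ℝ (normalHess G x a j) (normalHess G x c l))
      (by simp [inner_add_left]) (by simp [inner_smul_left]) (by simp [inner_add_right])
      (by simp [inner_smul_right]))
  have h2 := sum_gramOf_inv_eq hb (LinearMap.mk₂ ℝ
      (fun a c => ∑ q, inner ℝ (normalHessₗ G x a (b q)) (normalHessₗ G x c (b q)))
      (by simp [inner_add_left, Finset.sum_add_distrib])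
      (by simp [inner_smul_left, Finset.mul_sum])
      (by simp [inner_add_right, Finset.sum_add_distrib])
      (by simp [inner_smul_right, Finset.mul_sum]))
  simp only [LinearMap.mk₂_apply, normalHessₗ_apply, ← h1, smul_eq_mul] at h2
  simp only [h1, real_inner_self_eq_norm_sq] at h2
  change ∑ i, ∑ j, metricInv G x i j * _ = _ at h2
  rw [← h2, normSqA]
  refine Finset.sum_congr rfl fun i _ => ?_
  rw [Finset.sum_comm]
  refine Finset.sum_congr rfl fun k _ => ?_
  rw [← h1, Finset.mul_sum]
  refine Finset.sum_congr rfl fun j _ => ?_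
  rw [Finset.mul_sum]
  refine Finset.sum_congr rfl fun l _ => ?_
  simp only [normalHess_apply hinj]
  ring

variable {F : ℝ → E n → Amb n m} {t : ℝ} {x : E n}

/-- The evolution equation in terms of the components of the second fundamental form in a tangent
frame `dF(bᵢ)`. -/
theorem normalTimeDeriv_sub_laplacian_eq_frame {c : ℝ} {f : ℝ → E n → ℝ}
    (hF : ContDiffAt ℝ 3 (fun p : ℝ × E n => F p.1 p.2) (t, x))
    (hinj : Function.Injective (fderiv ℝ (F t) x))
    (hflow : ∀ᶠ y in 𝓝 x,
      deriv (fun s => F s y) t - traceHess (F t) y ∈ tangentSpace (F t) y)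
    (hf : (fun p : ℝ × E n => f p.1 p.2) =ᶠ[𝓝 (t, x)]
      fun p => c * unitOmega (fderiv ℝ (F p.1) p.2))
    {b : Fin n → E n} (hb : Orthonormal ℝ fun i => fderiv ℝ (F t) x (b i)) :
    normalTimeDeriv F f t x - laplacian (F t) (f t) x =
      c * (detOf b / |detOf b|) * ∑ k,
        (omega n m (fun i => fderiv ℝ (F t) x (b i)) * ∑ i, ‖normalHess (F t) x (b k) (b i)‖ ^ 2 -
        ∑ i, ∑ j ∈ Finset.univ.erase i,
          omega n m (Function.update (Function.update (fun l => fderiv ℝ (F t) x (b l)) i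
            (normalHess (F t) x (b k) (b i))) j (normalHess (F t) x (b k) (b j)))) := by
  rw [(normalTimeDeriv_sub_laplacian_eq hF hinj hflow hf).2]
  have h := sum_gramOf_inv_eq hb (LinearMap.mk₂ ℝ
    (fun a c => fderiv ℝ (fderiv ℝ unitOmega) (fderiv ℝ (F t) x) (normalHessₗ (F t) x a)
      (normalHessₗ (F t) x c)) (by simp) (by simp) (by simp) (by simp))
  simp only [LinearMap.mk₂_apply, normalHessₗ_apply, smul_eq_mul] at h
  have hd := detOf_ne_zero hb
  have hσ : (detOf b / |detOf b|) * (detOf b / |detOf b|) = 1 := by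
    rw [div_mul_div_comm, abs_mul_abs_self, div_self (mul_ne_zero hd hd)]
  have h2 := fun k => fderiv_fderiv_unitOmega_normal hinj hb
    (W := normalHess (F t) x (b k)) (inner_normalHess hinj (b k))
  change -(c * ∑ i, ∑ j, (gramOf (fderiv ℝ (F t) x))⁻¹ i j * _) = _
  rw [h]
  have h3 : ∀ k, omega n m (fun i => fderiv ℝ (F t) x (b i)) *
      ∑ i, ‖normalHess (F t) x (b k) (b i)‖ ^ 2 - ∑ i, ∑ j ∈ Finset.univ.erase i,
        omega n m (Function.update (Function.update (fun l => fderiv ℝ (F t) x (b l)) i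
          (normalHess (F t) x (b k) (b i))) j (normalHess (F t) x (b k) (b j))) =
      -(detOf b / |detOf b| * fderiv ℝ (fderiv ℝ unitOmega) (fderiv ℝ (F t) x)
        (normalHess (F t) x (b k)) (normalHess (F t) x (b k))) := fun k => by rw [h2]; ring
  simp only [h3, Finset.sum_neg_distrib, ← Finset.mul_sum]
  linear_combination (c * ∑ k, fderiv ℝ (fderiv ℝ unitOmega) (fderiv ℝ (F t) x)
        (normalHess (F t) x (b k)) (normalHess (F t) x (b k))) * hσ

lemma exists_orthonormal_tangent {L : E n →L[ℝ] Amb n m} (hL : Function.Injective L) :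
    ∃ b : Fin n → E n, Orthonormal ℝ fun i => L (b i) := by
  have hr : Module.finrank ℝ (LinearMap.range (L : E n →ₗ[ℝ] Amb n m)) = n := by
    rw [LinearMap.finrank_range_of_inj hL]; simp
  let o := (stdOrthonormalBasis ℝ (LinearMap.range (L : E n →ₗ[ℝ] Amb n m))).reindex (finCongr hr)
  have hex : ∀ i, ∃ v, L v = o i := fun i => (o i).2
  choose b hb using hex
  refine ⟨b, ?_⟩
  simp only [hb]
  exact o.orthonormal.comp_linearIsometry
    (LinearMap.range (L : E n →ₗ[ℝ] Amb n m)).subtypeₗᵢ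

lemma exists_orthonormal_normal {L : E n →L[ℝ] Amb n m} (hL : Function.Injective L) :
    ∃ ν : Fin m → Amb n m, Orthonormal ℝ ν ∧ ∀ v α, inner ℝ (L v) (ν α) = 0 := by
  set R := LinearMap.range (L : E n →ₗ[ℝ] Amb n m) with hR
  have hr : Module.finrank ℝ Rᗮ = m := by
    have h1 : Module.finrank ℝ R = n := by
      rw [hR, LinearMap.finrank_range_of_inj hL]; simp
    have h2 := R.finrank_add_finrank_orthogonal
    rw [h1] at h2
    simp at h2
    omega
  let o := (stdOrthonormalBasis ℝ Rᗮ).reindex (finCongr hr)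
  exact ⟨fun α => o α, o.orthonormal.comp_linearIsometry Rᗮ.subtypeₗᵢ,
    fun v α => (o α).2 _ ⟨v, rfl⟩⟩

/-- The differential inequality, for the sign `c` for which `f = c * unitOmega (dF)` is positive. -/
theorem normalTimeDeriv_sub_laplacian_ge {c : ℝ} (hc : c ^ 2 = 1) {f : ℝ → E n → ℝ}
    (hF : ContDiffAt ℝ 3 (fun p : ℝ × E n => F p.1 p.2) (t, x))
    (hinj : Function.Injective (fderiv ℝ (F t) x))
    (hflow : ∀ᶠ y in 𝓝 x,
      deriv (fun s => F s y) t - traceHess (F t) y ∈ tangentSpace (F t) y)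
    (hf : (fun p : ℝ × E n => f p.1 p.2) =ᶠ[𝓝 (t, x)]
      fun p => c * unitOmega (fderiv ℝ (F p.1) p.2))
    {δ : ℝ} (hδ : δ < 2) (hfδ : 1 / √(2 - δ) ≤ f t x) :
    normalTimeDeriv F f t x - laplacian (F t) (f t) x ≥ δ * f t x * normSqA (F t) x := by
  obtain ⟨b, hb⟩ := exists_orthonormal_tangent hinj
  obtain ⟨ν, hν, hbν⟩ := exists_orthonormal_normal hinj
  have hd := detOf_ne_zero hb
  set σ := detOf b / |detOf b| with hσd
  have hσ : σ * σ = 1 := by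
    rw [hσd, div_mul_div_comm, abs_mul_abs_self, div_self (mul_ne_zero hd hd)]
  set p := omega n m fun i => fderiv ℝ (F t) x (b i) with hp
  have hfx : f t x = c * σ * p := by
    have h1 : f t x = c * unitOmega (fderiv ℝ (F t) x) := hf.self_of_nhds
    have h2 : p = σ * unitOmega (fderiv ℝ (F t) x) := omega_orthonormal hb
    rw [h1, h2]
    linear_combination (-c * unitOmega (fderiv ℝ (F t) x)) * hσ
  have hfp : f t x ^ 2 = p ^ 2 := by
    rw [hfx]
    linear_combination (σ ^ 2 * p ^ 2) * hc + p ^ 2 * hσ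
  have hδ' : 0 < √(2 - δ) := Real.sqrt_pos.2 (by linarith)
  have hfpos : 0 < f t x := lt_of_lt_of_le (by positivity) hfδ
  have hp0 : p ≠ 0 := by
    intro h
    rw [h] at hfp
    exact hfpos.ne' (by simpa using hfp)
  have h1 : 1 ≤ (2 - δ) * f t x ^ 2 := by
    have h2 : 1 ≤ √(2 - δ) * f t x := by
      rw [div_le_iff₀ hδ'] at hfδ; linarith
    have h3 := mul_le_mul h2 h2 zero_le_one (by positivity)
    have h4 := Real.mul_self_sqrt (show 0 ≤ 2 - δ by linarith)
    calc (1 : ℝ) ≤ √(2 - δ) * f t x * (√(2 - δ) * f t x) := by linarith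
      _ = (√(2 - δ) * √(2 - δ)) * f t x ^ 2 := by ring
      _ = _ := by rw [h4]
  rw [normalTimeDeriv_sub_laplacian_eq_frame hF hinj hflow hf hb, normSqA_eq hinj hb,
    Finset.mul_sum, Finset.mul_sum]
  refine Finset.sum_le_sum fun k _ => ?_
  have hmain := omega_mul_sum_le hb hν (fun i α => hbν (b i) α) hp0
    (w := fun i => normalHess (F t) x (b k) (b i)) fun i j => inner_normalHess hinj _ _ _
  rw [← hp] at hmain
  set A := ∑ i, ‖normalHess (F t) x (b k) (b i)‖ ^ 2 with hA
  set S := ∑ i, ∑ j ∈ Finset.univ.erase i,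
    omega n m (Function.update (Function.update (fun l => fderiv ℝ (F t) x (b l)) i
      (normalHess (F t) x (b k) (b i))) j (normalHess (F t) x (b k) (b j))) with hS
  have hA0 : 0 ≤ A := by positivity
  -- Multiplying by `f > 0` removes the signs, as `f = c σ p`.
  have h5 : f t x * (δ * f t x * A) ≤ f t x * (c * σ * (p * A - S)) := by
    have e1 : f t x * (c * σ * (p * A - S)) = p ^ 2 * A - p * S := by
      rw [hfx]
      linear_combination (σ ^ 2 * p * (p * A - S)) * hc + (p * (p * A - S)) * hσ
    rw [e1]
    have h6 : p * S ≤ (1 - f t x ^ 2) * A := by rw [hfp]; exact hmain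
    rw [← hfp]
    nlinarith [mul_le_mul_of_nonneg_right h1 hA0]
  exact le_of_mul_le_mul_left h5 hfpos

/-! ### Mean curvature flows -/

namespace IsMeanCurvatureFlow

variable {J : Set ℝ} {Ω : Set (E n)} {F : ℝ → E n → Amb n m} {t : ℝ} {x : E n}

lemma contDiffAt (hF : IsMeanCurvatureFlow J Ω F) (hJ : IsOpen J) (hΩ : IsOpen Ω) (ht : t ∈ J)
    (hx : x ∈ Ω) : ContDiffAt ℝ 3 (fun p : ℝ × E n => F p.1 p.2) (t, x) :=
  hF.contDiffOn.contDiffAt ((hJ.prod hΩ).mem_nhds ⟨ht, hx⟩)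

lemma velocity_sub_traceHess_mem (hF : IsMeanCurvatureFlow J Ω F) (ht : t ∈ J) (hx : x ∈ Ω) :
    deriv (fun s => F s x) t - traceHess (F t) x ∈ tangentSpace (F t) x := by
  rw [(hF.flow t ht x hx).deriv, meanCurvature, traceHess]
  simp only [← Finset.sum_sub_distrib, ← smul_sub, secondFF, normalPart_eq (hF.immersion t ht x hx)]
  refine Submodule.sum_mem _ fun i _ => Submodule.sum_mem _ fun j _ => Submodule.smul_mem _ _ ?_
  rw [sub_sub_cancel_left]
  exact Submodule.neg_mem _ ⟨_, rfl⟩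

/-- The velocity of a mean curvature flow is normal, so that no tangential correction occurs. -/
lemma normalTimeDeriv_eq (hF : IsMeanCurvatureFlow J Ω F) (ht : t ∈ J) (hx : x ∈ Ω)
    (f : ℝ → E n → ℝ) : normalTimeDeriv F f t x = deriv (fun s => f s x) t := by
  have h : ∀ i, inner ℝ (deriv (fun s => F s x) t) (tang (F t) x i) = 0 := by
    intro i
    rw [(hF.flow t ht x hx).deriv, meanCurvature]
    simp only [sum_inner, real_inner_smul_left, secondFF,
      normalPart_eq (hF.immersion t ht x hx)]
    refine Finset.sum_eq_zero fun k _ => Finset.sum_eq_zero fun l _ => ?_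
    rw [real_inner_comm, tang, inner_sub_tangCoord (hF.immersion t ht x hx), mul_zero]
  simp [normalTimeDeriv, h]

lemma eventually_velocity (hF : IsMeanCurvatureFlow J Ω F) (hΩ : IsOpen Ω) (ht : t ∈ J)
    (hx : x ∈ Ω) : ∀ᶠ y in 𝓝 x,
      deriv (fun s => F s y) t - traceHess (F t) y ∈ tangentSpace (F t) y := by
  filter_upwards [hΩ.mem_nhds hx] with y hy using hF.velocity_sub_traceHess_mem ht hy

end IsMeanCurvatureFlow

/-! ### Frames and orientation -/

/-- Expansion of the second order term of the evolution equation in a normal frame. -/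
lemma omega_update_update_expand {τ : Fin n → Amb n m} {ν : Fin m → Amb n m} {i j : Fin n}
    (hij : i ≠ j) (c d : Fin m → ℝ) :
    omega n m (Function.update (Function.update τ i (∑ α, c α • ν α)) j (∑ β, d β • ν β)) =
      ∑ α, ∑ β, omega n m (Function.update (Function.update τ i (ν α)) j (ν β)) * c α * d β := by
  rw [Function.update_comm hij, AlternatingMap.map_update_sum]
  refine Finset.sum_congr rfl fun α _ => ?_
  rw [AlternatingMap.map_update_smul, Function.update_comm hij.symm, AlternatingMap.map_update_sum,
    smul_eq_mul, Finset.mul_sum]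
  refine Finset.sum_congr rfl fun β _ => ?_
  rw [AlternatingMap.map_update_smul, smul_eq_mul]
  ring

lemma eventually_div_abs_eq {X : Type*} [TopologicalSpace X] {g : X → ℝ} {x : X}
    (hg : ContinuousAt g x) (h0 : g x ≠ 0) :
    ∀ᶠ y in 𝓝 x, g y / |g y| = g x / |g x| := by
  rcases lt_or_gt_of_ne h0 with h | h
  · filter_upwards [hg.eventually (gt_mem_nhds h)] with y hy
    rw [abs_of_neg hy, abs_of_neg h, div_neg_self hy.ne, div_neg_self h.ne]
  · filter_upwards [hg.eventually (lt_mem_nhds h)] with y hy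
    rw [abs_of_pos hy, abs_of_pos h, div_self hy.ne', div_self h.ne']

lemma continuous_detOf : Continuous (detOf : (Fin n → E n) → ℝ) := by
  refine Continuous.matrix_det (continuous_matrix fun i j => ?_)
  simp only [Matrix.of_apply]
  fun_prop

/-- The value of `ω` on a continuous orthonormal tangent frame is locally `± ω(dF)`: the frame
may be replaced by the coordinate frame, as the orientation cannot change. -/
lemma eventuallyEq_of_frame {F : ℝ → E n → Amb n m} {t : ℝ} {x : E n}
    {e : ℝ → E n → Fin n → E n} {w : ℝ → E n → ℝ}
    (he : ContinuousAt (fun p : ℝ × E n => e p.1 p.2) (t, x))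
    (ho : ∀ᶠ p : ℝ × E n in 𝓝 (t, x),
      Orthonormal ℝ fun i => fderiv ℝ (F p.1) p.2 (e p.1 p.2 i))
    (hw : ∀ s y, w s y = omega n m fun i => fderiv ℝ (F s) y (e s y i)) :
    (fun p : ℝ × E n => w p.1 p.2) =ᶠ[𝓝 (t, x)]
      fun p => (detOf (e t x) / |detOf (e t x)|) * unitOmega (fderiv ℝ (F p.1) p.2) := by
  have h1 := eventually_div_abs_eq (continuous_detOf.continuousAt.comp he)
    (detOf_ne_zero ho.self_of_nhds)
  filter_upwards [h1, ho] with p hp hop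
  simp only [Function.comp_apply] at hp
  rw [hw, omega_orthonormal hop, hp]

/-! ### Graphs -/

/-- `fstPart` as a continuous linear map. -/
noncomputable def fstCLM (n m : ℕ) : Amb n m →L[ℝ] E n :=
  LinearMap.toContinuousLinearMap
    { toFun := fstPart, map_add' := fun _ _ => rfl, map_smul' := fun _ _ => rfl }

/-- `pair` as a continuous linear map. -/
noncomputable def pairCLM (n m : ℕ) : E n × E m →L[ℝ] Amb n m :=
  LinearMap.toContinuousLinearMap
    { toFun := fun p => pair p.1 p.2
      map_add' := fun p q => by ext (i | i) <;> simp [pair]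
      map_smul' := fun r p => by ext (i | i) <;> simp [pair] }

lemma inner_pair (v v' : E n) (w w' : E m) :
    inner ℝ (pair v w) (pair v' w') = inner ℝ v v' + inner ℝ w w' := by
  simp [pair, PiLp.inner_apply, Fintype.sum_sum_type]

variable {u : E n → E m} {y : E n}

lemma hasFDerivAt_graphMap (hu : DifferentiableAt ℝ u y) :
    HasFDerivAt (graphMap u)
      ((pairCLM n m).comp ((ContinuousLinearMap.id ℝ (E n)).prod (fderiv ℝ u y))) y :=
  HasFDerivAt.comp (g := pairCLM n m) (f := fun z => (z, u z)) y (pairCLM n m).hasFDerivAt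
    ((hasFDerivAt_id y).prodMk hu.hasFDerivAt)

lemma fderiv_graphMap_apply (hu : DifferentiableAt ℝ u y) (v : E n) :
    fderiv ℝ (graphMap u) y v = pair v (fderiv ℝ u y v) := by
  rw [(hasFDerivAt_graphMap hu).fderiv]
  rfl

lemma injective_fderiv_graphMap (hu : DifferentiableAt ℝ u y) :
    Function.Injective (fderiv ℝ (graphMap u) y) := by
  intro v w h
  rw [fderiv_graphMap_apply hu, fderiv_graphMap_apply hu] at h
  exact congrArg fstPart h

lemma gramOf_graphMap (hu : DifferentiableAt ℝ u y) :
    gramOf (fderiv ℝ (graphMap u) y) = 1 + (jacobian u y)ᵀ * jacobian u y := by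
  ext i j
  simp only [gramOf, Matrix.of_apply, fderiv_graphMap_apply hu, inner_pair]
  rw [Matrix.add_apply, Matrix.mul_apply]
  congr 1
  · rw [ei, EuclideanSpace.inner_single_left]
    simp [ei, Matrix.one_apply]
  · simp [jacobian, PiLp.inner_apply, mul_comm]

lemma unitOmega_graphMap (hu : DifferentiableAt ℝ u y) :
    unitOmega (fderiv ℝ (graphMap u) y) = starOmega u y := by
  rw [unitOmega, starOmega, gramOf_graphMap hu]
  congr 1
  rw [omega_apply, ← Matrix.det_one (n := Fin n) (R := ℝ)]
  congr 1
  ext i j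
  simp [fderiv_graphMap_apply hu, pair, ei, Matrix.one_apply, eq_comm]

/-- If the image of `G` lies on the graph of `u`, then `G` is a reparametrization of that graph. -/
lemma abs_unitOmega_eq_starOmega {G : E n → Amb n m} {x : E n} (hG : DifferentiableAt ℝ G x)
    (hinj : Function.Injective (fderiv ℝ G x)) (hu : DifferentiableAt ℝ u (fstPart (G x)))
    (hgraph : ∀ᶠ z in 𝓝 x, G z = graphMap u (fstPart (G z))) :
    |unitOmega (fderiv ℝ G x)| = starOmega u (fstPart (G x)) := by
  set A : E n →L[ℝ] E n := (fstCLM n m).comp (fderiv ℝ G x) with hA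
  have h1 : HasFDerivAt (fun z => fstPart (G z)) A x :=
    (fstCLM n m).hasFDerivAt.comp x hG.hasFDerivAt
  have h2 : fderiv ℝ G x = (fderiv ℝ (graphMap u) (fstPart (G x))).comp A := by
    have h3 := HasFDerivAt.comp (g := graphMap u) (f := fun z => fstPart (G z)) x
      (hasFDerivAt_graphMap hu).differentiableAt.hasFDerivAt h1
    exact (h3.congr_of_eventuallyEq hgraph).fderiv
  have hdet : (matOf A).det ≠ 0 := by
    intro h
    have h3 := (gramOf_det_pos hinj).ne'
    rw [h2, gramOf_comp, Matrix.det_mul, Matrix.det_mul, h, mul_zero, mul_zero] at h3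
    exact h3 rfl
  have hpos : 0 ≤ starOmega u (fstPart (G x)) := by rw [starOmega]; positivity
  rw [h2, unitOmega_comp, unitOmega_graphMap hu, abs_mul, abs_div, abs_abs,
    div_self (abs_ne_zero.2 hdet), one_mul, abs_of_nonneg hpos]

lemma jacobian_det_pos (hu : DifferentiableAt ℝ u y) :
    0 < (1 + (jacobian u y)ᵀ * jacobian u y).det := by
  rw [← gramOf_graphMap hu]
  exact gramOf_det_pos (injective_fderiv_graphMap hu)

lemma starOmega_pos (hu : DifferentiableAt ℝ u y) : 0 < starOmega u y :=
  one_div_pos.2 (Real.sqrt_pos.2 (jacobian_det_pos hu))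

/-- Along a flow of graphs `*ω` is locally `± ω(dF)`. -/
lemma eventuallyEq_of_graph {J : Set ℝ} {Ω : Set (E n)} {F : ℝ → E n → Amb n m} {t : ℝ} {x : E n}
    (hJ : IsOpen J) (hΩ : IsOpen Ω) (hF : IsMeanCurvatureFlow J Ω F) {U : ℝ → Set (E n)}
    {u : ℝ → E n → E m}
    (hu : ∀ t ∈ J, IsOpen (U t) ∧ DifferentiableOn ℝ (u t) (U t) ∧
      F t '' Ω = graphMap (u t) '' U t)
    {f : ℝ → E n → ℝ} (hf : ∀ s y, f s y = starOmega (u s) (fstPart (F s y))) (ht : t ∈ J)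
    (hx : x ∈ Ω) :
    ∃ c : ℝ, c ^ 2 = 1 ∧ (fun p : ℝ × E n => f p.1 p.2) =ᶠ[𝓝 (t, x)]
      fun p => c * unitOmega (fderiv ℝ (F p.1) p.2) := by
  have hmem : ∀ s ∈ J, ∀ y ∈ Ω, fstPart (F s y) ∈ U s ∧
      F s y = graphMap (u s) (fstPart (F s y)) := by
    intro s hs y hy
    obtain ⟨z, hz, hzy⟩ : F s y ∈ graphMap (u s) '' U s := (hu s hs).2.2 ▸ ⟨y, hy, rfl⟩
    have e : fstPart (F s y) = z := by rw [← hzy]; rfl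
    exact ⟨e ▸ hz, by rw [e, hzy]⟩
  have hdiff : ∀ s ∈ J, ∀ y ∈ Ω, DifferentiableAt ℝ (u s) (fstPart (F s y)) := fun s hs y hy =>
    (hu s hs).2.1.differentiableAt ((hu s hs).1.mem_nhds (hmem s hs y hy).1)
  have habs : ∀ s ∈ J, ∀ y ∈ Ω, |unitOmega (fderiv ℝ (F s) y)| = f s y := by
    intro s hs y hy
    rw [hf]
    refine abs_unitOmega_eq_starOmega ?_ (hF.immersion s hs y hy) (hdiff s hs y hy) ?_
    · exact (contDiffAt_slice (hF.contDiffAt hJ hΩ hs hy)).differentiableAt (by norm_num)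
    · filter_upwards [hΩ.mem_nhds hy] with z hz using (hmem s hs z hz).2
  set g : ℝ × E n → ℝ := fun p => unitOmega (fderiv ℝ (F p.1) p.2) with hg
  have hgc : ContinuousAt g (t, x) :=
    ContinuousAt.comp (g := unitOmega) (contDiffAt_unitOmega (hF.immersion t ht x hx)).continuousAt
      (contDiffAt_spaceDeriv (hF.contDiffAt hJ hΩ ht hx)).continuousAt
  have hg0 : g (t, x) ≠ 0 := by
    intro h
    have h1 := habs t ht x hx
    rw [show unitOmega (fderiv ℝ (F t) x) = 0 from h, abs_zero, hf] at h1
    exact (starOmega_pos (hdiff t ht x hx)).ne h1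
  refine ⟨g (t, x) / |g (t, x)|, by rw [div_pow, sq_abs, div_self (pow_ne_zero 2 hg0)], ?_⟩
  filter_upwards [eventually_div_abs_eq hgc hg0, hgc.eventually_ne hg0,
    (hJ.prod hΩ).mem_nhds ⟨ht, hx⟩] with p h1 h2 h3
  rw [← h1, ← habs p.1 h3.1 p.2 h3.2]
  change |g p| = g p / |g p| * g p
  rw [div_mul_eq_mul_div, ← abs_mul_abs_self, mul_div_cancel_right₀ _ (abs_ne_zero.2 h2)]

/-! ### The non-parametric flow -/

lemma traceHess_graphMap (hu : ContDiffAt ℝ 2 u y) :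
    traceHess (graphMap u) y = pair 0 (∑ i, ∑ j,
      ((1 + (jacobian u y)ᵀ * jacobian u y)⁻¹ : Matrix (Fin n) (Fin n) ℝ) i j •
        fderiv ℝ (fderiv ℝ u) y (ei i) (ei j)) := by
  have h1 : fderiv ℝ (graphMap u) =ᶠ[𝓝 y] fun z =>
      (pairCLM n m).comp ((ContinuousLinearMap.id ℝ (E n)).prod (fderiv ℝ u z)) := by
    filter_upwards [hu.eventually_differentiableAt] with z hz using (hasFDerivAt_graphMap hz).fderiv
  have h2 : ∀ a b, fderiv ℝ (fderiv ℝ (graphMap u)) y a b =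
      pair 0 (fderiv ℝ (fderiv ℝ u) y a b) := by
    intro a b
    have hd : DifferentiableAt ℝ (fderiv ℝ (graphMap u)) y := by
      have hg : ContDiffAt ℝ 2 (graphMap u) y :=
        ContDiffAt.comp (g := pairCLM n m) (f := fun z => (z, u z)) y
          (pairCLM n m).contDiff.contDiffAt (contDiffAt_id.prodMk hu)
      exact hg.differentiableAt_fderiv
    rw [← fderiv_fderiv_apply hd]
    have h3 : (fun z => fderiv ℝ (graphMap u) z b) =ᶠ[𝓝 y] fun z =>
        pairCLM n m (b, fderiv ℝ u z b) := h1.mono fun z hz => by simp only [hz]; rfl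
    have h4 : HasFDerivAt (fun z => fderiv ℝ u z b) ((fderiv ℝ (fderiv ℝ u) y).flip b) y := by
      refine (hu.differentiableAt_fderiv.hasFDerivAt.clm_apply
        (hasFDerivAt_const b y)).congr_fderiv ?_
      ext1 v
      simp
    have h5 := HasFDerivAt.comp (g := pairCLM n m) (f := fun z => (b, fderiv ℝ u z b)) y
      (pairCLM n m).hasFDerivAt ((hasFDerivAt_const b y).prodMk h4)
    rw [h3.fderiv_eq]
    exact (congrArg (fun T => T a) h5.fderiv)
  have h3 : ∀ v : E m, pair (0 : E n) v = pairCLM n m (ContinuousLinearMap.inr ℝ (E n) (E m) v) :=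
    fun v => rfl
  simp only [traceHess, h2, h3, map_sum, map_smul]
  rw [← gramOf_graphMap (hu.differentiableAt two_ne_zero)]
  rfl

lemma contDiffAt_graphMap {v : ℝ → E n → E m} {t : ℝ} {x : E n}
    (hv : ContDiffAt ℝ 3 (fun p : ℝ × E n => v p.1 p.2) (t, x)) :
    ContDiffAt ℝ 3 (fun p : ℝ × E n => graphMap (v p.1) p.2) (t, x) :=
  ContDiffAt.comp (g := pairCLM n m) (f := fun p : ℝ × E n => (p.2, v p.1 p.2)) (t, x)
    (pairCLM n m).contDiff.contDiffAt (contDiffAt_snd.prodMk hv)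

namespace IsGraphicalFlow

variable {J : Set ℝ} {Ω : Set (E n)} {v : ℝ → E n → E m} {t : ℝ} {x : E n}

lemma contDiffAt (hv : IsGraphicalFlow J Ω v) (hJ : IsOpen J) (hΩ : IsOpen Ω) (ht : t ∈ J)
    (hx : x ∈ Ω) : ContDiffAt ℝ 3 (fun p : ℝ × E n => v p.1 p.2) (t, x) :=
  hv.contDiffOn.contDiffAt ((hJ.prod hΩ).mem_nhds ⟨ht, hx⟩)

/-- The velocity of the graph map is the full trace of its Hessian. -/
lemma deriv_graphMap (hv : IsGraphicalFlow J Ω v) (hJ : IsOpen J) (hΩ : IsOpen Ω) (ht : t ∈ J)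
    (hx : x ∈ Ω) : deriv (fun s => graphMap (v s) x) t = traceHess (graphMap (v t)) x := by
  rw [traceHess_graphMap ((contDiffAt_slice (hv.contDiffAt hJ hΩ ht hx)).of_le (by norm_num))]
  exact (((pairCLM n m).hasFDerivAt).comp_hasDerivAt t
    ((hasDerivAt_const t x).prodMk (hv.flow t ht x hx))).deriv

lemma starOmega_eventuallyEq (hv : IsGraphicalFlow J Ω v) (hJ : IsOpen J) (hΩ : IsOpen Ω)
    (ht : t ∈ J) (hx : x ∈ Ω) : (fun p : ℝ × E n => starOmega (v p.1) p.2) =ᶠ[𝓝 (t, x)]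
      fun p => 1 * unitOmega (fderiv ℝ (graphMap (v p.1)) p.2) := by
  filter_upwards [(hJ.prod hΩ).mem_nhds ⟨ht, hx⟩] with p hp
  rw [one_mul, unitOmega_graphMap
    ((contDiffAt_slice (hv.contDiffAt hJ hΩ hp.1 hp.2)).differentiableAt (by norm_num))]

end IsGraphicalFlow

end GraphMCF

end

theorem mainTheorem5 (n m : ℕ) :
    -- Evolution of `ω₁...ₙ = ω(τ₁, …, τₙ)`, `τᵢ = dF(eᵢ)`, along the mean curvature flow.
    (∀ (J : Set ℝ) (Ω : Set (E n)) (F : ℝ → E n → Amb n m), IsOpen J → IsOpen Ω →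
      IsMeanCurvatureFlow J Ω F → ∀ t ∈ J, ∀ x ∈ Ω,
      ∀ (e : ℝ → E n → Fin n → E n) (w : ℝ → E n → ℝ) (ν : Fin m → Amb n m),
      ContinuousAt (fun p : ℝ × E n => e p.1 p.2) (t, x) →
      (∀ᶠ p : ℝ × E n in nhds (t, x),
        Orthonormal ℝ (fun i => fderiv ℝ (F p.1) p.2 (e p.1 p.2 i))) →
      (∀ s y, w s y = omega n m (fun i => fderiv ℝ (F s) y (e s y i))) →
      Orthonormal ℝ ν → (∀ α, ν α ∈ (tangentSpace (F t) x)ᗮ) →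
      ∀ (τ : Fin n → Amb n m) (h : Fin m → Fin n → Fin n → ℝ),
      (∀ i, τ i = fderiv ℝ (F t) x (e t x i)) →
      (∀ α i k, h α i k = inner ℝ (secondFF (F t) x (e t x i) (e t x k)) (ν α)) →
      ContDiffAt ℝ 2 (fun p : ℝ × E n => w p.1 p.2) (t, x) ∧
      deriv (fun s => w s x) t - laplacian (F t) (w t) x =
        omega n m τ * ∑ α, ∑ i, ∑ k, h α i k ^ 2 -
          ∑ i, ∑ j ∈ Finset.univ.erase i, ∑ k, ∑ α, ∑ β,
            omega n m (Function.update (Function.update τ i (ν α)) j (ν β)) *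
              h α i k * h β j k) ∧
    -- The estimate along a mean curvature flow whose time slices are graphs.
    (∀ (J : Set ℝ) (Ω : Set (E n)) (F : ℝ → E n → Amb n m), IsOpen J → IsOpen Ω →
      IsMeanCurvatureFlow J Ω F →
      ∀ (U : ℝ → Set (E n)) (u : ℝ → E n → E m),
      (∀ t ∈ J, IsOpen (U t) ∧ DifferentiableOn ℝ (u t) (U t) ∧
        F t '' Ω = graphMap (u t) '' U t) →
      ∀ f : ℝ → E n → ℝ, (∀ s y, f s y = starOmega (u s) (fstPart (F s y))) →
      ∀ t ∈ J, ∀ x ∈ Ω, ContDiffAt ℝ 2 (fun p : ℝ × E n => f p.1 p.2) (t, x) ∧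
      ∀ δ : ℝ, δ < 2 → 1 / Real.sqrt (2 - δ) ≤ f t x →
        deriv (fun s => f s x) t - laplacian (F t) (f t) x ≥ δ * f t x * normSqA (F t) x) ∧
    -- The estimate for solutions of the non-parametric mean curvature flow system.
    (∀ (J : Set ℝ) (Ω : Set (E n)) (u : ℝ → E n → E m), IsOpen J → IsOpen Ω →
      IsGraphicalFlow J Ω u →
      ∀ t ∈ J, ∀ x ∈ Ω,
      ContDiffAt ℝ 2 (fun p : ℝ × E n => starOmega (u p.1) p.2) (t, x) ∧
      ∀ δ : ℝ, δ < 2 → 1 / Real.sqrt (2 - δ) ≤ starOmega (u t) x →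
        normalTimeDeriv (fun s => graphMap (u s)) (fun s => starOmega (u s)) t x -
            laplacian (graphMap (u t)) (starOmega (u t)) x ≥
          δ * starOmega (u t) x * normSqA (graphMap (u t)) x) := by
  refine ⟨?_, ?_, ?_⟩
  · intro J Ω F hJ hΩ hF t ht x hx e w ν he ho hw hν hνT τ h hτ hh
    have hinj := hF.immersion t ht x hx
    have hFC := hF.contDiffAt hJ hΩ ht hx
    have hb : Orthonormal ℝ fun i => fderiv ℝ (F t) x (e t x i) := ho.self_of_nhds
    have hwe := eventuallyEq_of_frame he ho hw
    have hflow := hF.eventually_velocity hΩ ht hx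
    refine ⟨(normalTimeDeriv_sub_laplacian_eq hFC hinj hflow hwe).1, ?_⟩
    have hd := detOf_ne_zero hb
    have hσ : detOf (e t x) / |detOf (e t x)| * (detOf (e t x) / |detOf (e t x)|) = 1 := by
      rw [div_mul_div_comm, abs_mul_abs_self, div_self (mul_ne_zero hd hd)]
    have hτ' : τ = fun i => fderiv ℝ (F t) x (e t x i) := funext hτ
    have hτν : ∀ i α, inner ℝ (τ i) (ν α) = 0 := fun i α => by
      rw [hτ]; exact hνT α _ ⟨_, rfl⟩
    have hτo : Orthonormal ℝ τ := hτ' ▸ hb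
    -- `h` is symmetric in its tangential indices.
    have hhk : ∀ α i k, inner ℝ (normalHess (F t) x (e t x k) (e t x i)) (ν α) = h α i k := by
      intro α i k
      rw [hh, normalHess_apply hinj, secondFF, secondFF,
        ((contDiffAt_slice hFC).of_le (by norm_num)).snd_fderiv_symm]
    have hn : ∀ k i j, inner ℝ (τ i) (normalHess (F t) x (e t x k) (e t x j)) = 0 := by
      intro k i j
      rw [hτ]; exact inner_normalHess hinj _ _ _
    rw [← hF.normalTimeDeriv_eq ht hx, normalTimeDeriv_sub_laplacian_eq_frame hFC hinj hflow hwe hb,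
      hσ, one_mul, ← hτ', Finset.sum_sub_distrib]
    congr 1
    · rw [← Finset.mul_sum]
      congr 1
      have h1 : ∀ k i, ‖normalHess (F t) x (e t x k) (e t x i)‖ ^ 2 = ∑ α, h α i k ^ 2 := by
        intro k i
        rw [norm_sq_eq_sum_of_normal hτo hν hτν fun j => hn k j i]
        simp only [hhk]
      simp only [h1]
      rw [Finset.sum_comm, Finset.sum_comm (s := Finset.univ) (t := Finset.univ)
        (f := fun α i => ∑ k, h α i k ^ 2)]
      exact Finset.sum_congr rfl fun i _ => Finset.sum_comm
    · rw [Finset.sum_comm]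
      refine Finset.sum_congr rfl fun i _ => ?_
      rw [Finset.sum_comm]
      refine Finset.sum_congr rfl fun j hj => Finset.sum_congr rfl fun k _ => ?_
      rw [eq_sum_of_normal hτo hν hτν fun l => hn k l i,
        eq_sum_of_normal hτo hν hτν fun l => hn k l j,
        omega_update_update_expand (Finset.ne_of_mem_erase hj).symm]
      simp only [hhk]
  · intro J Ω F hJ hΩ hF U u hu f hf t ht x hx
    obtain ⟨c, hc, hfc⟩ := eventuallyEq_of_graph hJ hΩ hF hu hf ht hx
    have hinj := hF.immersion t ht x hx
    have hFC := hF.contDiffAt hJ hΩ ht hx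
    have hflow := hF.eventually_velocity hΩ ht hx
    refine ⟨(normalTimeDeriv_sub_laplacian_eq hFC hinj hflow hfc).1, fun δ hδ hfδ => ?_⟩
    rw [← hF.normalTimeDeriv_eq ht hx]
    exact normalTimeDeriv_sub_laplacian_ge hc hFC hinj hflow hfc hδ hfδ
  · intro J Ω u hJ hΩ hu t ht x hx
    have hC := hu.contDiffAt hJ hΩ ht hx
    have hinj := injective_fderiv_graphMap ((contDiffAt_slice hC).differentiableAt (by norm_num))
    have hflow : ∀ᶠ y in nhds x, deriv (fun s => graphMap (u s) y) t -
        traceHess (graphMap (u t)) y ∈ tangentSpace (graphMap (u t)) y := by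
      filter_upwards [hΩ.mem_nhds hx] with y hy
      rw [hu.deriv_graphMap hJ hΩ ht hy, sub_self]
      exact Submodule.zero_mem _
    have hfe := hu.starOmega_eventuallyEq hJ hΩ ht hx
    exact ⟨(normalTimeDeriv_sub_laplacian_eq (F := fun s => graphMap (u s))
        (f := fun s => starOmega (u s)) (contDiffAt_graphMap hC) hinj hflow hfe).1,
      fun δ hδ hfδ => normalTimeDeriv_sub_laplacian_ge (F := fun s => graphMap (u s))
        (f := fun s => starOmega (u s)) (one_pow 2) (contDiffAt_graphMap hC) hinj hflow hfe hδ hfδ⟩
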